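/- Let $(M^3,g)$ be a connected smooth Riemannian 3-manifold with Levi-Civita connection $\nabla$ and curvature $R(X,Y)=\nabla_X\nabla_Y-\nabla_Y\nabla_X-\nabla_{[X,Y]}$, endowed with an almost contact metric structure $(\chi,\xi,\eta,g)$, i.e. $\eta=g(\xi,\cdot)$, $\chi^2X=-X+\eta(X)\xi$, $g(\xi,\xi)=1$, $\chi\xi=0$, $g(\chi X,\chi Y)=g(X,Y)-\eta(X)\eta(Y)$, and oriented so that the orthonormal frames $\{e_1,e_2=\chi e_1,e_3=\xi\}$ are positive. Let $c_1,c_2\in\mathbb R$, let $E$ be a smooth field of $g$-symmetric endomorphisms of $TM$, $V$ a smooth vector field and $h$ a smooth real function on $M$. Put $$fX=-hX+2h\,\eta(X)\xi-\eta(X)\,\chi V+g(V,\chi X)\,\xi ,$$ that is, $f$ has in the frame above the entries $(fe_1,e_1)=(fe_2,e_2)=-h$, $(fe_1,e_2)=0$, $(f\xi,e_1)=(fe_1,\xi)=(V,e_2)$, $(f\xi,e_2)=(fe_2,\xi)=-(V,e_1)$, $(f\xi,\xi)=h$. The Gauss equation for $\mathbb M_1(c_1)\times\mathbb M_2(c_2)$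 is $$R(X,Y)Z=\tfrac{c_1}{4}\big((X+fX)\wedge(Y+fY)\big)Z+\tfrac{c_2}{4}\big((X-fX)\wedge(Y-fY)\big)Z+g(EY,Z)EX-g(EX,Z)EY$$ for all smooth vector fields $X,Y,Z$, where $(A\wedge B)Z=g(B,Z)A-g(A,Z)B$, and the Codazzi equation is $$\begin{aligned}g\big((\nabla_XE)Y-(\nabla_YE)X,Z\big)=&\tfrac{c_1}{4}\big(g(fY,Z)g(V,X)-g(fX,Z)g(V,Y)+g(Y,Z)g(V,X)-g(X,Z)g(V,Y)\big)\\&-\tfrac{c_2}{4}\big(g(Y,Z)g(V,X)-g(Y,fZ)g(V,X)-g(X,Z)g(Y,V)+g(X,fZ)g(V,Y)\big)\end{aligned}$$ for all smooth vector fields $X,Y,Z$. A Spin$^c$ structure on $M$ with a connection on its auxiliary line bundle is described by its spinor bundle $\Sigma M$: a rank-2 Hermitian complex vector bundle with Clifford multiplication $\gamma$ (with $\gamma(X)^2=-|X|^2$, $\gamma(X)$ skew-Hermitian, and $-\gamma(e_1)\gamma(e_2)\gamma(e_3)=\mathrm{Id}$ for positive orthonormal frames) and a Hermitian connection satisfying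 $\nabla_X(\gamma(Y)\psi)=\gamma(\nabla_XY)\psi+\gamma(Y)\nabla_X\psi$. The auxiliary line bundle is $\det\Sigma M$ with the induced connection; its curvature is written $i\Omega$ with $\Omega$ a real 2-form. (1) Suppose that $g(V,\xi)=0$ and $h^2+\|V\|^2=1$ on $M$, and that $M$ has a Spin$^c$ structure $(\gamma_1,\nabla^1,\Omega^1)$ with a smooth spinor field $\varphi_1\not\equiv0$ satisfying, for all $X$, $$\nabla^1_X\varphi_1=-\tfrac12\gamma_1(EX)\varphi_1,\qquad \gamma_1(\xi)\varphi_1=-i\varphi_1,$$ and that, in every frame $\{e_1,e_2=\chi e_1,\xi\}$, $$\Omega^1(e_1,e_2)=\tfrac{c_1}{2}(h-1)-\tfrac{c_2}{2}(h+1),\qquad \Omega^1(e_k,\xi)=\tfrac{c_1-c_2}{2}\,g(V,e_k)\quad(k=1,2).$$ Then the Gauss equation for $\mathbb M_1(c_1)\times\mathbb M_2(c_2)$ holds on $M$ if and only if the Codazzi equation holds on $M$. (2) Suppose that $M$ has a Spin$^c$ structure $(\gamma_2,\nabla^2,\Omega^2)$ with a smooth spinor field $\varphi_2\not\equiv0$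 satisfying, for all $X$, $$\nabla^2_X\varphi_2=\tfrac12\gamma_2(EX)\varphi_2,\qquad \gamma_2(V)\varphi_2=-i\gamma_2(\xi)\varphi_2+h\varphi_2,$$ and that, in every frame $\{e_1,e_2=\chi e_1,\xi\}$, $$\Omega^2(e_1,e_2)=-\tfrac{c_1}{2}(h-1)-\tfrac{c_2}{2}(h+1),\qquad \Omega^2(e_k,\xi)=-\tfrac{c_1+c_2}{2}\,g(V,e_k)\quad(k=1,2).$$ Then the Gauss equation for $\mathbb M_1(c_1)\times\mathbb M_2(c_2)$ holds on $M$ if and only if the Codazzi equation holds on $M$. -/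

import Mathlib

open Bundle Module
open scoped Manifold ContDiff

-- The real inner product `Re (·, ·)` of a complex inner product space.
attribute [local instance] InnerProductSpace.complexToReal

noncomputable section

/-! ### Curvature of a connection and exterior covariant derivative of an endomorphism field -/

section Connections

variable {E : Type*} [NormedAddCommGroup E] [NormedSpace ℝ E] [FiniteDimensional ℝ E]
  {M : Type*} [TopologicalSpace M] [ChartedSpace E M]
  [IsManifold 𝓘(ℝ, E) ∞ M]

/-- `R(X, Y) σ = ∇_X ∇_Y σ - ∇_Y ∇_X σ - ∇_[X, Y] σ` for a connection `∇` on a vector bundle.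
(`cov σ x v` is `∇_v σ` at `x`.) -/
def curvature {F : Type*} [NormedAddCommGroup F] [NormedSpace ℝ F]
    {W : M → Type*} [TopologicalSpace (TotalSpace F W)]
    [∀ x, AddCommGroup (W x)] [∀ x, Module ℝ (W x)] [∀ x, TopologicalSpace (W x)]
    [∀ x, IsTopologicalAddGroup (W x)] [∀ x, ContinuousSMul ℝ (W x)] [FiberBundle F W]
    (cov : CovariantDerivative 𝓘(ℝ, E) F W)
    (X Y : ∀ x : M, TangentSpace 𝓘(ℝ, E) x) (σ : ∀ x : M, W x) (x : M) : W x :=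
  cov (fun y => cov σ y (Y y)) x (X x) - cov (fun y => cov σ y (X y)) x (Y x)
    - cov σ x (VectorField.mlieBracket 𝓘(ℝ, E) X Y x)

/-- `d^∇ A (X, Y) = (∇_X A) Y - (∇_Y A) X` for a field `A` of endomorphisms of the tangent
bundle, where `(∇_X A) Y = ∇_X (A Y) - A (∇_X Y)`. -/
def dNabla (cov : CovariantDerivative 𝓘(ℝ, E) E (TangentSpace 𝓘(ℝ, E) : M → Type _))
    (A : ∀ x : M, TangentSpace 𝓘(ℝ, E) x →L[ℝ] TangentSpace 𝓘(ℝ, E) x)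
    (X Y : ∀ x : M, TangentSpace 𝓘(ℝ, E) x) (x : M) : TangentSpace 𝓘(ℝ, E) x :=
  (cov (fun y => A y (Y y)) x (X x) - A x (cov Y x (X x)))
    - (cov (fun y => A y (X y)) x (Y x) - A x (cov X x (Y x)))

/-- A smooth vector field. -/
def SmoothField (X : ∀ x : M, TangentSpace 𝓘(ℝ, E) x) : Prop :=
  ContMDiff 𝓘(ℝ, E) (𝓘(ℝ, E).prod 𝓘(ℝ, E)) ∞ (fun x => TotalSpace.mk' E x (X x))

/-- A smooth field of endomorphisms of the tangent bundle. -/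
def SmoothEndo
    (A : ∀ x : M, TangentSpace 𝓘(ℝ, E) x →L[ℝ] TangentSpace 𝓘(ℝ, E) x) : Prop :=
  ContMDiff 𝓘(ℝ, E) (𝓘(ℝ, E).prod 𝓘(ℝ, E →L[ℝ] E)) ∞
    (fun x => TotalSpace.mk' (E →L[ℝ] E)
      (E := fun x : M => TangentSpace 𝓘(ℝ, E) x →L[ℝ] TangentSpace 𝓘(ℝ, E) x) x (A x))

end Connections

/-! ### Riemannian geometry of the base -/

section Riemannian

variable {E : Type*} [NormedAddCommGroup E] [NormedSpace ℝ E] [FiniteDimensional ℝ E]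
  {M : Type*} [TopologicalSpace M] [ChartedSpace E M] [IsManifold 𝓘(ℝ, E) ∞ M]
  [RiemannianBundle (fun x : M => TangentSpace 𝓘(ℝ, E) x)]
  [IsContMDiffRiemannianBundle 𝓘(ℝ, E) ∞ E (fun x : M => TangentSpace 𝓘(ℝ, E) x)]

/-- `∇` is the Levi-Civita connection: smooth, metric and torsion-free. -/
structure IsLeviCivita
    (cov : CovariantDerivative 𝓘(ℝ, E) E (TangentSpace 𝓘(ℝ, E) : M → Type _)) : Prop where
  smooth : CovariantDerivative.ContMDiffCovariantDerivative cov ∞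
  metric : CovariantDerivative.IsMetricCompatible (V := fun x : M => TangentSpace 𝓘(ℝ, E) x) cov
  torsion_free : cov.torsion = 0

/-- An almost contact metric structure `(χ, ξ, η, g)` on `(M, g)`, with `η = g(ξ, ·)`. -/
structure AlmostContact {E : Type*} [NormedAddCommGroup E] [NormedSpace ℝ E]
    [FiniteDimensional ℝ E] (M : Type*) [TopologicalSpace M] [ChartedSpace E M]
    [IsManifold 𝓘(ℝ, E) ∞ M] [RiemannianBundle (fun x : M => TangentSpace 𝓘(ℝ, E) x)]
    [IsContMDiffRiemannianBundle 𝓘(ℝ, E) ∞ E (fun x : M => TangentSpace 𝓘(ℝ, E) x)] where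
  /-- The endomorphism field `χ`. -/
  χ : ∀ x : M, TangentSpace 𝓘(ℝ, E) x →L[ℝ] TangentSpace 𝓘(ℝ, E) x
  /-- The Reeb field `ξ`. -/
  ξ : ∀ x : M, TangentSpace 𝓘(ℝ, E) x
  smooth_χ : SmoothEndo χ
  smooth_ξ : SmoothField ξ
  χ_sq : ∀ x (v : TangentSpace 𝓘(ℝ, E) x), χ x (χ x v) = -v + inner ℝ (ξ x) v • ξ x
  unit_ξ : ∀ x, inner ℝ (ξ x) (ξ x) = (1 : ℝ)
  χ_ξ : ∀ x, χ x (ξ x) = 0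
  compatible : ∀ x (v w : TangentSpace 𝓘(ℝ, E) x),
    inner ℝ (χ x v) (χ x w) = inner ℝ v w - inner ℝ (ξ x) v * inner ℝ (ξ x) w

namespace AlmostContact

variable (C : AlmostContact (E := E) M)

/-- The orthonormal basis `e` of `T_x M` is of the form `{e₁, e₂ = χ e₁, e₃ = ξ}`. -/
def IsAdapted {x : M} (e : OrthonormalBasis (Fin 3) ℝ (TangentSpace 𝓘(ℝ, E) x)) : Prop :=
  e 1 = C.χ x (e 0) ∧ e 2 = C.ξ x

/-- The orientation `o` of `M` is the one for which every frame `{e₁, χ e₁, ξ}` is positive. -/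
def IsOriented (o : ∀ x : M, Orientation ℝ (TangentSpace 𝓘(ℝ, E) x) (Fin 3)) : Prop :=
  ∀ (x : M) (e : OrthonormalBasis (Fin 3) ℝ (TangentSpace 𝓘(ℝ, E) x)),
    C.IsAdapted e → e.toBasis.orientation = o x

/-- The tangential part `f` of the product structure `F = f + (V, ·) ν`, `F ν = V + h ν`, given by
the function `h` and the vector field `V`: the field of endomorphisms
`f X = -h X + 2 h η(X) ξ - η(X) χ V + (V, χ X) ξ`.
In a frame `{e₁, e₂ = χ e₁, ξ}` it reads `(f e₁, e₁) = (f e₂, e₂) = -h`, `(f e₁, e₂) = 0`,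
`(f ξ, e₁) = (f e₁, ξ) = (V, e₂)`, `(f ξ, e₂) = (f e₂, ξ) = -(V, e₁)` and `(f ξ, ξ) = h`. -/
def prodEndo (h : M → ℝ) (V : ∀ x : M, TangentSpace 𝓘(ℝ, E) x) (x : M)
    (v : TangentSpace 𝓘(ℝ, E) x) : TangentSpace 𝓘(ℝ, E) x :=
  -(h x) • v + (2 * h x * inner ℝ (C.ξ x) v) • C.ξ x
    - (inner ℝ (C.ξ x) v : ℝ) • C.χ x (V x) + (inner ℝ (V x) (C.χ x v) : ℝ) • C.ξ x

end AlmostContact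

/-- `(a ∧ b) z = g(b, z) a - g(a, z) b`. -/
def wedge {x : M} (a b z : TangentSpace 𝓘(ℝ, E) x) : TangentSpace 𝓘(ℝ, E) x :=
  (inner ℝ b z : ℝ) • a - (inner ℝ a z : ℝ) • b

/-- The Gauss equation for `𝕄₁(c₁) × 𝕄₂(c₂)` with shape operator `A`. -/
def GaussEquation
    (cov : CovariantDerivative 𝓘(ℝ, E) E (TangentSpace 𝓘(ℝ, E) : M → Type _))
    (C : AlmostContact (E := E) M) (c₁ c₂ : ℝ)
    (A : ∀ x : M, TangentSpace 𝓘(ℝ, E) x →L[ℝ] TangentSpace 𝓘(ℝ, E) x)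
    (V : ∀ x : M, TangentSpace 𝓘(ℝ, E) x) (h : M → ℝ) : Prop :=
  ∀ X Y Z : ∀ x : M, TangentSpace 𝓘(ℝ, E) x,
    SmoothField X → SmoothField Y → SmoothField Z → ∀ x : M,
    curvature cov X Y Z x =
      (c₁ / 4) • wedge (X x + C.prodEndo h V x (X x)) (Y x + C.prodEndo h V x (Y x)) (Z x)
      + (c₂ / 4) • wedge (X x - C.prodEndo h V x (X x)) (Y x - C.prodEndo h V x (Y x)) (Z x)
      + ((inner ℝ (A x (Y x)) (Z x) : ℝ) • A x (X x)
        - (inner ℝ (A x (X x)) (Z x) : ℝ) • A x (Y x))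

/-- The Codazzi equation for `𝕄₁(c₁) × 𝕄₂(c₂)` with shape operator `A`. -/
def CodazziEquation
    (cov : CovariantDerivative 𝓘(ℝ, E) E (TangentSpace 𝓘(ℝ, E) : M → Type _))
    (C : AlmostContact (E := E) M) (c₁ c₂ : ℝ)
    (A : ∀ x : M, TangentSpace 𝓘(ℝ, E) x →L[ℝ] TangentSpace 𝓘(ℝ, E) x)
    (V : ∀ x : M, TangentSpace 𝓘(ℝ, E) x) (h : M → ℝ) : Prop :=
  ∀ X Y Z : ∀ x : M, TangentSpace 𝓘(ℝ, E) x,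
    SmoothField X → SmoothField Y → SmoothField Z → ∀ x : M,
    inner ℝ (dNabla cov A X Y x) (Z x) =
      (c₁ / 4) * (inner ℝ (C.prodEndo h V x (Y x)) (Z x) * inner ℝ (V x) (X x)
          - inner ℝ (C.prodEndo h V x (X x)) (Z x) * inner ℝ (V x) (Y x)
          + inner ℝ (Y x) (Z x) * inner ℝ (V x) (X x)
          - inner ℝ (X x) (Z x) * inner ℝ (V x) (Y x))
      - (c₂ / 4) * (inner ℝ (Y x) (Z x) * inner ℝ (V x) (X x)
          - inner ℝ (Y x) (C.prodEndo h V x (Z x)) * inner ℝ (V x) (X x)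
          - inner ℝ (X x) (Z x) * inner ℝ (Y x) (V x)
          + inner ℝ (X x) (C.prodEndo h V x (Z x)) * inner ℝ (V x) (Y x))

end Riemannian

/-! ### Spinᶜ structures in dimension three -/

/-- A smooth spinor field: a smooth section of the vector bundle `S` with model fibre `F`. -/
def SmoothSpinor (E : Type*) [NormedAddCommGroup E] [NormedSpace ℝ E]
    {M : Type*} [TopologicalSpace M] [ChartedSpace E M]
    (F : Type*) [NormedAddCommGroup F] [NormedSpace ℂ F]
    {S : M → Type*} [TopologicalSpace (TotalSpace F S)]
    [∀ x, NormedAddCommGroup (S x)] [FiberBundle F S] (σ : ∀ x : M, S x) : Prop :=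
  ContMDiff 𝓘(ℝ, E) (𝓘(ℝ, E).prod 𝓘(ℝ, F)) ∞ (fun x => TotalSpace.mk' F x (σ x))

section Spinc

variable {E : Type*} [NormedAddCommGroup E] [NormedSpace ℝ E] [FiniteDimensional ℝ E]
  {M : Type*} [TopologicalSpace M] [ChartedSpace E M] [IsManifold 𝓘(ℝ, E) ∞ M]
  [RiemannianBundle (fun x : M => TangentSpace 𝓘(ℝ, E) x)]
  [IsContMDiffRiemannianBundle 𝓘(ℝ, E) ∞ E (fun x : M => TangentSpace 𝓘(ℝ, E) x)]

/-- A Spinᶜ structure on the oriented Riemannian 3-manifold `(M, g, o)`, with a connection on its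
auxiliary line bundle, given by its spinor bundle `S`: a smooth Hermitian complex vector bundle of
rank 2 (the type-class arguments; the fibrewise real inner product is `Re (·, ·)`) with a Clifford
multiplication `γ` and a Hermitian connection for which `γ` is parallel with respect to the
Levi-Civita connection. A complex module of rank 2 over the Clifford algebra of dimension 3 is
irreducible, and the auxiliary line bundle is `det S = Λ² S` with the induced connection. -/
structure SpincStructure
    (cov : CovariantDerivative 𝓘(ℝ, E) E (TangentSpace 𝓘(ℝ, E) : M → Type _))
    (o : ∀ x : M, Orientation ℝ (TangentSpace 𝓘(ℝ, E) x) (Fin 3))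
    {F : Type*} [NormedAddCommGroup F] [NormedSpace ℂ F] [FiniteDimensional ℂ F]
    (S : M → Type*) [TopologicalSpace (TotalSpace F S)]
    [∀ x, NormedAddCommGroup (S x)] [∀ x, InnerProductSpace ℂ (S x)]
    [FiberBundle F S] [VectorBundle ℂ F S] [VectorBundle ℝ F S]
    [ContMDiffVectorBundle ∞ F S 𝓘(ℝ, E)]
    [IsContMDiffRiemannianBundle 𝓘(ℝ, E) ∞ F S] where
  rank_two : finrank ℂ F = 2
  /-- Clifford multiplication. -/
  γ : ∀ x : M, TangentSpace 𝓘(ℝ, E) x →L[ℝ] S x →L[ℝ] S x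
  /-- The spinorial connection. -/
  conn : CovariantDerivative 𝓘(ℝ, E) F S
  smooth_γ : ContMDiff 𝓘(ℝ, E) (𝓘(ℝ, E).prod 𝓘(ℝ, E →L[ℝ] F →L[ℝ] F)) ∞
    (fun x => TotalSpace.mk' (E →L[ℝ] F →L[ℝ] F)
      (E := fun x : M => TangentSpace 𝓘(ℝ, E) x →L[ℝ] S x →L[ℝ] S x) x (γ x))
  γ_complex : ∀ x v (z : ℂ) (s : S x), γ x v (z • s) = z • γ x v s
  γ_sq : ∀ x (v : TangentSpace 𝓘(ℝ, E) x) (s : S x),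
    γ x v (γ x v s) = -((inner ℝ v v : ℝ) • s)
  γ_skew : ∀ x (v : TangentSpace 𝓘(ℝ, E) x) (s t : S x),
    inner ℂ (γ x v s) t = -inner ℂ s (γ x v t)
  /-- The complex volume element `-e₁ e₂ e₃` acts as the identity. -/
  volume : ∀ (x : M) (e : OrthonormalBasis (Fin 3) ℝ (TangentSpace 𝓘(ℝ, E) x)),
    e.toBasis.orientation = o x →
      ∀ s : S x, -(γ x (e 0) (γ x (e 1) (γ x (e 2) s))) = s
  smooth_conn : CovariantDerivative.ContMDiffCovariantDerivative conn ∞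
  conn_complex : ∀ (x : M) (σ : ∀ x : M, S x) (z : ℂ) (v : TangentSpace 𝓘(ℝ, E) x),
    MDifferentiableAt 𝓘(ℝ, E) (𝓘(ℝ, E).prod 𝓘(ℝ, F)) (fun y => TotalSpace.mk' F y (σ y)) x →
      conn (fun y => z • σ y) x v = z • conn σ x v
  conn_metric : conn.IsMetricCompatible
  conn_γ : ∀ (x : M) (Y : ∀ x : M, TangentSpace 𝓘(ℝ, E) x) (σ : ∀ x : M, S x)
    (v : TangentSpace 𝓘(ℝ, E) x),
    MDifferentiableAt 𝓘(ℝ, E) (𝓘(ℝ, E).prod 𝓘(ℝ, E)) (fun y => TotalSpace.mk' E y (Y y)) x →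
    MDifferentiableAt 𝓘(ℝ, E) (𝓘(ℝ, E).prod 𝓘(ℝ, F)) (fun y => TotalSpace.mk' F y (σ y)) x →
      conn (fun y => γ y (Y y) (σ y)) x v = γ x (cov Y x v) (σ x) + γ x (Y x) (conn σ x v)

namespace SpincStructure

variable {cov : CovariantDerivative 𝓘(ℝ, E) E (TangentSpace 𝓘(ℝ, E) : M → Type _)}
    {o : ∀ x : M, Orientation ℝ (TangentSpace 𝓘(ℝ, E) x) (Fin 3)}
    {F : Type*} [NormedAddCommGroup F] [NormedSpace ℂ F] [FiniteDimensional ℂ F]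
    {S : M → Type*} [TopologicalSpace (TotalSpace F S)]
    [∀ x, NormedAddCommGroup (S x)] [∀ x, InnerProductSpace ℂ (S x)]
    [FiberBundle F S] [VectorBundle ℂ F S] [VectorBundle ℝ F S]
    [ContMDiffVectorBundle ∞ F S 𝓘(ℝ, E)]
    [IsContMDiffRiemannianBundle 𝓘(ℝ, E) ∞ F S]

/-- `s ∧ t` in the fibre `Λ² S_x` of the auxiliary line bundle. -/
def detWedge {x : M} (s t : S x) : ⋀[ℂ]^2 (S x) := exteriorPower.ιMulti ℂ 2 ![s, t]

/-- `iΩ` is the curvature of the auxiliary line bundle `Λ² S`, whose connection is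
`∇(σ ∧ τ) = ∇σ ∧ τ + σ ∧ ∇τ` and whose curvature is accordingly
`σ ∧ τ ↦ R(X, Y)σ ∧ τ + σ ∧ R(X, Y)τ`. -/
def IsAuxiliaryCurvature (P : SpincStructure cov o (F := F) S)
    (Ω : ∀ x : M, TangentSpace 𝓘(ℝ, E) x →L[ℝ] TangentSpace 𝓘(ℝ, E) x →L[ℝ] ℝ) : Prop :=
  ∀ X Y : ∀ x : M, TangentSpace 𝓘(ℝ, E) x, SmoothField X → SmoothField Y →
    ∀ σ τ : ∀ x : M, S x, SmoothSpinor E F σ → SmoothSpinor E F τ → ∀ x : M,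
      detWedge (curvature P.conn X Y σ x) (τ x) + detWedge (σ x) (curvature P.conn X Y τ x) =
        (Complex.I * (Ω x (X x) (Y x) : ℂ)) • detWedge (σ x) (τ x)

end SpincStructure

end Spinc

end

/-! Write everything as vectors acting by the cross product. For fixed `X`, `Y` the equation `∇φ =
(ε/2) γ(A ·) φ`, `ε = ±1`, gives the spinor curvature `R(X,Y)φ = γ(u)φ` with `2u = ε d^∇A(X,Y) - AX
× AY`. Rank two leaves little freedom: the value on the nonvanishing `φ`, the trace `iΩ(X,Y)` on the
determinant line and compatibility with `γ` force the Riemannian curvature to be the cross product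
with `2u + Ω(X,Y)σ`, where `σ` is the direction of `φ`, `γ(σ)φ = -iφ` (`eq_cross_of_areaForm`,
`curvature_eq_cross`).

Let `G` and `K` be the vectors `gaussVector` and `codazziVector`. The Gauss equation reads `R(X,Y)Z
= -(G + AX × AY) × Z` and the Codazzi equation `d^∇A(X,Y) = K`. The prescribed `Ω` satisfies `G + εK
= -Ωσ`, an algebraic identity resting on `V ⊥ ξ` and `h² + |V|² = 1`. Substitution yields `R(X,Y)Z +
(G + AX × AY) × Z = ε (d^∇A(X,Y) - K) × Z`. A vector whose cross product with every `Z` vanishes is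
zero, so the left side vanishes for all `Z` exactly when Codazzi holds
(`gaussEquation_iff_codazziEquation`).

In (1), `ε = -1` and `σ = ξ`. In (2), `ε = 1` and `σ = hξ - χV`; there the algebraic spinor equation
itself implies `V ⊥ ξ` and `h² + |V|² = 1` (`direction_of_apply_eq`). -/

set_option linter.unusedSectionVars false

noncomputable section

/-! ### Linear algebra of the cross product and of Clifford multiplication in dimension three -/

section Cross

variable {T : Type*} [NormedAddCommGroup T] [InnerProductSpace ℝ T]

/-- The cross product of an oriented Euclidean 3-space, expressed by a unit vector `ξ` and the
rotation `χ` by a right angle about `ξ`. -/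
def cross (χ : T →ₗ[ℝ] T) (ξ u v : T) : T :=
  (inner ℝ (χ u) v : ℝ) • ξ + (inner ℝ ξ u : ℝ) • χ v - (inner ℝ ξ v : ℝ) • χ u

/-- `χ` is the rotation by a right angle about `ξ`, in terms of an orthonormal frame. -/
structure IsRotationFrame (χ : T →ₗ[ℝ] T) (ξ : T) (e : OrthonormalBasis (Fin 3) ℝ T) : Prop where
  zero : χ (e 0) = e 1
  one : χ (e 1) = -e 0
  two : χ (e 2) = 0
  axis : e 2 = ξ

variable {χ : T →ₗ[ℝ] T} {ξ : T} {e : OrthonormalBasis (Fin 3) ℝ T}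

theorem OrthonormalBasis.eq_of_inner_fin_three {u v : T} (e : OrthonormalBasis (Fin 3) ℝ T)
    (h0 : inner ℝ (e 0) u = (inner ℝ (e 0) v : ℝ)) (h1 : inner ℝ (e 1) u = (inner ℝ (e 1) v : ℝ))
    (h2 : inner ℝ (e 2) u = (inner ℝ (e 2) v : ℝ)) : u = v := by
  rw [← e.sum_repr' u, ← e.sum_repr' v, Fin.sum_univ_three, Fin.sum_univ_three, h0, h1, h2]

theorem OrthonormalBasis.sum_inner_fin_three (e : OrthonormalBasis (Fin 3) ℝ T) (u : T) :
    u = (inner ℝ (e 0) u : ℝ) • e 0 + (inner ℝ (e 1) u : ℝ) • e 1 + (inner ℝ (e 2) u : ℝ) • e 2 := by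
  conv_lhs => rw [← e.sum_repr' u]
  rw [Fin.sum_univ_three]

theorem OrthonormalBasis.inner_fin_three (e : OrthonormalBasis (Fin 3) ℝ T) (u v : T) :
    inner ℝ u v = inner ℝ (e 0) u * inner ℝ (e 0) v + inner ℝ (e 1) u * inner ℝ (e 1) v
      + (inner ℝ (e 2) u * inner ℝ (e 2) v : ℝ) := by
  rw [← e.sum_inner_mul_inner u v, Fin.sum_univ_three]
  simp only [real_inner_comm]

namespace IsRotationFrame

theorem apply (hf : IsRotationFrame χ ξ e) (u : T) :
    χ u = -(inner ℝ (e 1) u : ℝ) • e 0 + (inner ℝ (e 0) u : ℝ) • e 1 := by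
  conv_lhs => rw [e.sum_inner_fin_three u]
  simp only [map_add, map_smul, hf.zero, hf.one, hf.two]
  module

theorem inner_zero (hf : IsRotationFrame χ ξ e) (u : T) :
    inner ℝ (e 0) (χ u) = -(inner ℝ (e 1) u : ℝ) := by
  simp [hf.apply u, inner_add_right, inner_smul_right]

theorem inner_one (hf : IsRotationFrame χ ξ e) (u : T) :
    inner ℝ (e 1) (χ u) = (inner ℝ (e 0) u : ℝ) := by
  simp [hf.apply u, inner_add_right, inner_smul_right]

theorem inner_two (hf : IsRotationFrame χ ξ e) (u : T) :
    inner ℝ (e 2) (χ u) = (0 : ℝ) := by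
  simp [hf.apply u, inner_add_right, inner_smul_right]

theorem cross_zero (hf : IsRotationFrame χ ξ e) (u v : T) :
    inner ℝ (e 0) (cross χ ξ u v) =
      (inner ℝ (e 1) u * inner ℝ (e 2) v - inner ℝ (e 2) u * inner ℝ (e 1) v : ℝ) := by
  simp only [cross, ← hf.axis, inner_add_right, inner_sub_right, inner_smul_right, hf.inner_zero]
  simp
  ring

theorem cross_one (hf : IsRotationFrame χ ξ e) (u v : T) :
    inner ℝ (e 1) (cross χ ξ u v) =
      (inner ℝ (e 2) u * inner ℝ (e 0) v - inner ℝ (e 0) u * inner ℝ (e 2) v : ℝ) := by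
  simp only [cross, ← hf.axis, inner_add_right, inner_sub_right, inner_smul_right, hf.inner_one]
  simp
  ring

theorem cross_two (hf : IsRotationFrame χ ξ e) (u v : T) :
    inner ℝ (e 2) (cross χ ξ u v) =
      (inner ℝ (e 0) u * inner ℝ (e 1) v - inner ℝ (e 1) u * inner ℝ (e 0) v : ℝ) := by
  simp only [cross, ← hf.axis, inner_add_right, inner_sub_right, inner_smul_right, hf.inner_two,
    e.inner_fin_three (χ u), hf.inner_one, hf.inner_zero]
  simp
  ring

theorem cross_swap (hf : IsRotationFrame χ ξ e) (u v : T) :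
    cross χ ξ u v = -cross χ ξ v u := by
  apply e.eq_of_inner_fin_three <;> rw [inner_neg_right] <;>
  simp only [hf.cross_zero, hf.cross_one, hf.cross_two] <;> ring

/-- Each coordinate of `w` is, up to sign, a coordinate of its product with a frame vector. This
injectivity is what turns Gauss into Codazzi. -/
theorem eq_zero_of_cross (hf : IsRotationFrame χ ξ e) {w : T} (h : ∀ v, cross χ ξ w v = 0) :
    w = 0 := by
  have h0 : ∀ i v, inner ℝ (e i) (cross χ ξ w v) = (0 : ℝ) := by simp [h]
  apply e.eq_of_inner_fin_three
  · simpa [hf.cross_two] using h0 2 (e 1)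
  · simpa [hf.cross_two] using h0 2 (e 0)
  · simpa [hf.cross_one] using h0 1 (e 0)

end IsRotationFrame

theorem cross_add_left (χ : T →ₗ[ℝ] T) (ξ u v w : T) :
    cross χ ξ (u + v) w = cross χ ξ u w + cross χ ξ v w := by
  simp only [cross, map_add, inner_add_left, inner_add_right]
  module

theorem cross_smul_left (χ : T →ₗ[ℝ] T) (ξ : T) (r : ℝ) (u w : T) :
    cross χ ξ (r • u) w = r • cross χ ξ u w := by
  simp only [cross, map_smul, real_inner_smul_left, real_inner_smul_right]
  module

end Cross

/-! ### Adapted orthonormal frames of an almost contact metric structure -/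

section Frames

variable {T : Type*} [NormedAddCommGroup T] [InnerProductSpace ℝ T] {χ : T →ₗ[ℝ] T} {ξ : T}

/-- For any unit `a ⊥ ξ` the triple `a, χ a, ξ` is orthonormal, because `χ` takes values in `ξ^⊥`
and is skew. -/
theorem exists_orthonormalBasis_of_contact (hT : finrank ℝ T = 3)
    (χ_sq : ∀ v, χ (χ v) = -v + (inner ℝ ξ v : ℝ) • ξ) (unit_ξ : inner ℝ ξ ξ = (1 : ℝ))
    (χ_ξ : χ ξ = 0)
    (compatible : ∀ v w, inner ℝ (χ v) (χ w) = inner ℝ v w - inner ℝ ξ v * (inner ℝ ξ w : ℝ)) :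
    ∃ e : OrthonormalBasis (Fin 3) ℝ T, e 1 = χ (e 0) ∧ e 2 = ξ := by
  have : FiniteDimensional ℝ T := .of_finrank_pos (by omega)
  have hξ0 : ξ ≠ 0 := by rintro rfl; simp at unit_ξ
  -- Compute `χ³ v` in two ways: as `χ²` of `χ v`, and as `χ` of `χ² v`.
  have hξχ : ∀ v, inner ℝ ξ (χ v) = (0 : ℝ) := fun v => by
    have h1 := χ_sq (χ v)
    rw [χ_sq v, map_add, map_smul, χ_ξ, smul_zero, add_zero, map_neg] at h1
    simpa [hξ0] using h1
  have hskew : ∀ v, inner ℝ v (χ v) = (0 : ℝ) := fun v => by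
    have h1 := compatible (χ v) v
    rw [χ_sq, hξχ, inner_add_left, inner_neg_left, inner_smul_left, hξχ,
      real_inner_comm v (χ v)] at h1
    simp only [mul_zero, zero_mul, sub_zero, add_zero] at h1
    linarith
  obtain ⟨a, ha, haξ⟩ : ∃ a : T, ‖a‖ = 1 ∧ inner ℝ ξ a = (0 : ℝ) := by
    have hd : finrank ℝ (ℝ ∙ ξ)ᗮ = 2 := by
      have := (ℝ ∙ ξ).finrank_add_finrank_orthogonal
      rw [finrank_span_singleton hξ0, hT] at this
      omega
    have : Nontrivial (ℝ ∙ ξ)ᗮ := nontrivial_of_finrank_pos (R := ℝ) (by omega)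
    obtain ⟨a, ha⟩ := exists_norm_eq (ℝ ∙ ξ)ᗮ zero_le_one
    exact ⟨a, by simpa using ha, Submodule.mem_orthogonal_singleton_iff_inner_right.1 a.2⟩
  have haa : inner ℝ a a = (1 : ℝ) := by simp [ha]
  have hon : Orthonormal ℝ ![a, χ a, ξ] := by
    rw [orthonormal_iff_ite]
    intro i j
    fin_cases i <;> fin_cases j <;>
      simp [haa, unit_ξ, haξ, hξχ, hskew, compatible, real_inner_comm ξ, real_inner_comm a (χ a),
        -inner_self_eq_norm_sq_to_K]
  refine ⟨(basisOfOrthonormalOfCardEqFinrank hon (by simp [hT])).toOrthonormalBasis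
    (by rwa [coe_basisOfOrthonormalOfCardEqFinrank]), ?_⟩
  simp

theorem isRotationFrame_of_adapted
    (χ_sq : ∀ v, χ (χ v) = -v + (inner ℝ ξ v : ℝ) • ξ) (χ_ξ : χ ξ = 0)
    (e : OrthonormalBasis (Fin 3) ℝ T) (h1 : e 1 = χ (e 0)) (h2 : e 2 = ξ) :
    IsRotationFrame χ ξ e where
  zero := h1.symm
  one := by rw [h1, χ_sq, ← h2]; simp
  two := by rw [h2, χ_ξ]
  axis := h2

end Frames

/-! ### The determinant of a complex plane in coordinates -/

section Area

variable {W : Type*} [AddCommGroup W] [Module ℂ W] (b : Basis (Fin 2) ℂ W)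

/-- The area form of a complex plane with respect to a basis. -/
def areaForm (s t : W) : ℂ := b.repr s 0 * b.repr t 1 - b.repr s 1 * b.repr t 0

theorem areaForm_add_left (s s' t : W) : areaForm b (s + s') t = areaForm b s t + areaForm b s' t := by
  simp only [areaForm, map_add, Finsupp.add_apply]; ring

theorem areaForm_add_right (s t t' : W) :
    areaForm b s (t + t') = areaForm b s t + areaForm b s t' := by
  simp only [areaForm, map_add, Finsupp.add_apply]; ring

theorem areaForm_smul_left (z : ℂ) (s t : W) : areaForm b (z • s) t = z * areaForm b s t := by
  simp only [areaForm, map_smul, Finsupp.smul_apply, smul_eq_mul]; ring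

theorem areaForm_smul_right (z : ℂ) (s t : W) : areaForm b s (z • t) = z * areaForm b s t := by
  simp only [areaForm, map_smul, Finsupp.smul_apply, smul_eq_mul]; ring

theorem areaForm_swap (s t : W) : areaForm b t s = -areaForm b s t := by
  simp only [areaForm]; ring

theorem areaForm_eq_det (s t : W) : areaForm b s t = b.det ![s, t] := by
  simp [areaForm, Basis.det_apply, Matrix.det_fin_two, Basis.toMatrix_apply]; ring

/-- The derivation of `Λ²` induced by `L` is multiplication by the trace. This is how the auxiliary
curvature enters as a trace. -/
theorem areaForm_trace (L : End ℂ W) (s t : W) :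
    areaForm b (L s) t + areaForm b s (L t) = LinearMap.trace ℂ W L * areaForm b s t := by
  have h : ∀ i v, b.repr (L v) i = LinearMap.toMatrix b b L i 0 * b.repr v 0
      + LinearMap.toMatrix b b L i 1 * b.repr v 1 := fun i v => by
    rw [← LinearMap.toMatrix_mulVec_repr b b L v, Matrix.mulVec, dotProduct, Fin.sum_univ_two]
  rw [LinearMap.trace_eq_matrix_trace ℂ b, Matrix.trace_fin_two]
  simp only [areaForm, h]
  ring

theorem exists_eq_smul_of_areaForm_eq_zero {s t : W} (hs : s ≠ 0) (h : areaForm b s t = 0) :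
    ∃ z : ℂ, t = z • s := by
  have h' : b.repr s 0 * b.repr t 1 = b.repr s 1 * b.repr t 0 := sub_eq_zero.1 h
  by_cases h0 : b.repr s 0 = 0
  · have h1 : b.repr s 1 ≠ 0 := fun h1 => hs <| b.ext_elem fun i => by
      fin_cases i <;> simpa
    refine ⟨b.repr t 1 / b.repr s 1, b.ext_elem fun i => ?_⟩
    fin_cases i <;> simp [h0, h1]
    simpa [h0, h1] using h'.symm
  · refine ⟨b.repr t 0 / b.repr s 0, b.ext_elem fun i => ?_⟩
    fin_cases i <;> simp [h0]
    field_simp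
    linear_combination h'

end Area

/-! ### Clifford modules of rank two and the rigidity of their derivations -/

section Clifford

variable {T : Type*} [NormedAddCommGroup T] [InnerProductSpace ℝ T] {χ : T →ₗ[ℝ] T} {ξ : T}
  {W : Type*} [NormedAddCommGroup W] [InnerProductSpace ℂ W]

/-- A Clifford action of an oriented Euclidean 3-space by skew-Hermitian endomorphisms, for which
the complex volume element acts as the identity. -/
structure IsCliffordAction (χ : T →ₗ[ℝ] T) (ξ : T) (γ : T → End ℂ W) : Prop where
  map_add : ∀ u v, γ (u + v) = γ u + γ v
  map_smul : ∀ (r : ℝ) u, γ (r • u) = (r : ℂ) • γ u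
  mul : ∀ u v, γ u * γ v = -((inner ℝ u v : ℝ) : ℂ) • 1 + γ (cross χ ξ u v)
  skew : ∀ v s t, inner ℂ (γ v s) t = -inner ℂ s (γ v t)

namespace IsCliffordAction

variable {γ : T → End ℂ W} (hγ : IsCliffordAction χ ξ γ) {e : OrthonormalBasis (Fin 3) ℝ T}
  (hf : IsRotationFrame χ ξ e)

include hγ

theorem map_neg (v : T) : γ (-v) = -γ v := by
  simpa using hγ.map_smul (-1) v

theorem map_sub (u v : T) : γ (u - v) = γ u - γ v := by
  rw [sub_eq_add_neg, hγ.map_add, hγ.map_neg, sub_eq_add_neg]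

include hf

theorem commutator (u v : T) : γ u * γ v - γ v * γ u = (2 : ℂ) • γ (cross χ ξ u v) := by
  rw [hγ.mul, hγ.mul v u, hf.cross_swap v u, hγ.map_neg, real_inner_comm]
  module

theorem map_cross (u v : T) : γ (cross χ ξ u v) = (1 / 2 : ℂ) • (γ u * γ v - γ v * γ u) := by
  rw [hγ.commutator hf, smul_smul]; norm_num

/-- Every frame vector is a cross product, so its Clifford action is a multiple of a commutator. -/
theorem trace_eq_zero (v : T) : LinearMap.trace ℂ W (γ v) = 0 := by
  have h : ∀ u v, LinearMap.trace ℂ W (γ (cross χ ξ u v)) = 0 := fun u v => by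
    rw [hγ.map_cross hf, _root_.map_smul, _root_.map_sub, LinearMap.trace_mul_comm, sub_self,
      smul_zero]
  have h2 : cross χ ξ (e 0) (e 1) = e 2 := by
    apply e.eq_of_inner_fin_three <;> simp [hf.cross_zero, hf.cross_one, hf.cross_two]
  have h0 : cross χ ξ (e 1) (e 2) = e 0 := by
    apply e.eq_of_inner_fin_three <;> simp [hf.cross_zero, hf.cross_one, hf.cross_two]
  have h1 : cross χ ξ (e 2) (e 0) = e 1 := by
    apply e.eq_of_inner_fin_three <;> simp [hf.cross_zero, hf.cross_one, hf.cross_two]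
  rw [e.sum_inner_fin_three v]
  simp only [hγ.map_add, hγ.map_smul, _root_.map_add, _root_.map_smul]
  rw [← h2, h, ← h0, h, ← h1, h]
  simp

theorem apply_apply_self (v : T) (s : W) : γ v (γ v s) = -((inner ℝ v v : ℝ) : ℂ) • s := by
  have h : cross χ ξ v v = 0 := by
    apply e.eq_of_inner_fin_three <;> simp [hf.cross_zero, hf.cross_one, hf.cross_two, mul_comm]
  have h0 : γ 0 = 0 := by simpa using hγ.map_smul 0 0
  have := LinearMap.congr_fun (hγ.mul v v) s
  rwa [h, h0, add_zero] at this

theorem eq_zero_of_apply_eq_zero {v : T} {s : W} (hs : s ≠ 0) (h : γ v s = 0) : v = 0 := by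
  have h1 := hγ.apply_apply_self hf v s
  rw [h, LinearMap.map_zero, eq_comm, smul_eq_zero] at h1
  simpa [hs] using h1

omit hf in
theorem re_inner_apply (v : T) (s : W) : (inner ℂ s (γ v s)).re = 0 := by
  have h := congrArg Complex.re (hγ.skew v s s)
  rw [← inner_conj_symm, Complex.conj_re, Complex.neg_re] at h
  linarith

/-- Skewness makes the eigenvalue `z` purely imaginary, so `v + (Im z) σ` annihilates `s`; a vector
annihilating a nonzero spinor is zero since `γ(v)² = -|v|²`. -/
theorem exists_eq_smul_of_apply_eq_smul {v σ : T} {s : W} {z : ℂ} (hs : s ≠ 0)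
    (hσ : γ σ s = -(Complex.I • s)) (h : γ v s = z • s) : ∃ t : ℝ, v = t • σ := by
  have hre := hγ.re_inner_apply v s
  rw [h, inner_smul_right, inner_self_eq_norm_sq_to_K] at hre
  have hz : z.re = 0 := by
    have hn : ‖s‖ ≠ 0 := norm_ne_zero_iff.2 hs
    have h2 : (z * ((‖s‖ ^ 2 : ℝ) : ℂ)).re = 0 := by
      rw [Complex.ofReal_pow]
      exact hre
    rw [Complex.re_mul_ofReal] at h2
    simpa [hn] using h2
  refine ⟨-z.im, ?_⟩
  have hz' : z = z.im * Complex.I := by apply Complex.ext <;> simp [hz]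
  have : v + z.im • σ = 0 := by
    apply hγ.eq_zero_of_apply_eq_zero hf hs
    rw [hγ.map_add, hγ.map_smul, LinearMap.add_apply, LinearMap.smul_apply, h, hσ, hz']
    simp [smul_smul]
  rw [neg_smul]
  exact eq_neg_of_add_eq_zero_left this

/-- If the derivation `B` of the Clifford module, whose value at `s` is `γ(u) s`, has trace `i w`
and covers the operation `r` on vectors, then `r` is the cross product with `2 u + w σ`, where
`γ(σ) s = -i s`. -/
theorem eq_cross_of_areaForm (b : Basis (Fin 2) ℂ W) {s : W} (hs : s ≠ 0) {σ : T}
    (hσ : γ σ s = -(Complex.I • s)) {ι : Type*} {ev r : ι → T} (hev : Function.Surjective ev)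
    (u : T) (w : ℝ)
    (h₁ : ∀ Z, areaForm b (γ u s) (γ (ev Z) s) + areaForm b s (γ (r Z) s + γ (ev Z) (γ u s)) =
      Complex.I * w * areaForm b s (γ (ev Z) s))
    (h₂ : ∀ Z Z', areaForm b (γ (r Z) s + γ (ev Z) (γ u s)) (γ (ev Z') s)
        + areaForm b (γ (ev Z) s) (γ (r Z') s + γ (ev Z') (γ u s)) =
      Complex.I * w * areaForm b (γ (ev Z) s) (γ (ev Z') s)) (Z : ι) :
    r Z = cross χ ξ ((2 : ℝ) • u + w • σ) (ev Z) := by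
  -- The candidate derivation. The correction `γ σ + i` kills `s`, so `B s = γ(u) s`; since `γ` is
  -- traceless and the rank is 2, it contributes trace `i w`. Moreover `[B, γ v] = γ((2u + wσ) ×
  -- v)`, and `δ` measures the failure of `r` to be this cross product.
  set B : End ℂ W := γ u + (w / 2 : ℂ) • (γ σ + Complex.I • 1) with hB
  set δ : ι → T := fun Z => r Z - cross χ ξ ((2 : ℝ) • u + w • σ) (ev Z) with hδ
  have htr : LinearMap.trace ℂ W B = Complex.I * w := by
    have := Module.Finite.of_basis b
    have h1 : LinearMap.trace ℂ W 1 = 2 := by simp [LinearMap.trace_one, finrank_eq_card_basis b]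
    simp only [hB, _root_.map_add, _root_.map_smul, hγ.trace_eq_zero hf, h1, smul_eq_mul]
    ring
  have hBs : γ u s = B s := by simp [hB, hσ]
  have hr : ∀ Z, γ (r Z) s + γ (ev Z) (γ u s) = γ (δ Z) s + B (γ (ev Z) s) := fun Z => by
    have h1 := LinearMap.congr_fun (hγ.map_cross hf u (ev Z)) s
    have h2 := LinearMap.congr_fun (hγ.map_cross hf σ (ev Z)) s
    simp only [LinearMap.smul_apply, LinearMap.sub_apply, Module.End.mul_apply, hσ, _root_.map_neg,
      _root_.map_smul] at h1 h2
    simp only [hδ, hγ.map_sub, cross_add_left, cross_smul_left, hγ.map_add, hγ.map_smul,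
      LinearMap.sub_apply, LinearMap.add_apply, LinearMap.smul_apply, h1, h2, hB,
      Module.End.one_apply]
    push_cast
    module
  -- Subtracting the trace identity for `B` from `h₁` leaves `s ∧ γ(δ Z) s = 0`, so `s` is an
  -- eigenvector of `γ(δ Z)`.
  have hd : ∀ Z, ∃ t : ℝ, δ Z = t • σ := fun Z => by
    have h := h₁ Z
    rw [hr, areaForm_add_right, hBs] at h
    have h' : areaForm b s (γ (δ Z) s) = 0 := by
      have := areaForm_trace b B s (γ (ev Z) s)
      rw [htr] at this
      linear_combination h - this
    obtain ⟨z, hz⟩ := exists_eq_smul_of_areaForm_eq_zero b hs h'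
    exact hγ.exists_eq_smul_of_apply_eq_smul hf hs hσ hz
  choose t ht using hd
  have hγδ : ∀ Z, γ (δ Z) s = (-(t Z : ℂ) * Complex.I) • s := fun Z => by
    rw [ht, hγ.map_smul, LinearMap.smul_apply, hσ]; module
  -- The pair `(s, γ(Z) s)` leaves the component of `δ` along `σ` undetermined; `h₂` supplies the
  -- missing relation.
  have hpair : ∀ Z Z', ∃ k : ℝ, t Z • ev Z' - t Z' • ev Z = k • σ := fun Z Z' => by
    have h := h₂ Z Z'
    rw [hr, hr, areaForm_add_left, areaForm_add_right, hγδ, hγδ, areaForm_smul_left,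
      areaForm_smul_right, areaForm_swap b s] at h
    have h3 := areaForm_trace b B (γ (ev Z) s) (γ (ev Z') s)
    rw [htr] at h3
    have h' : areaForm b s (γ (t Z • ev Z' - t Z' • ev Z) s) = 0 := by
      have h4 : -Complex.I * areaForm b s (γ (t Z • ev Z' - t Z' • ev Z) s) = 0 := by
        rw [sub_eq_add_neg, ← neg_smul, hγ.map_add, hγ.map_smul, hγ.map_smul, LinearMap.add_apply,
          LinearMap.smul_apply, LinearMap.smul_apply, areaForm_add_right, areaForm_smul_right,
          areaForm_smul_right]
        push_cast
        linear_combination h - h3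
      simpa using h4
    obtain ⟨z, hz⟩ := exists_eq_smul_of_areaForm_eq_zero b hs h'
    exact hγ.exists_eq_smul_of_apply_eq_smul hf hs hσ hz
  -- Dimension 3 provides a vector outside this plane. Using it as `ev Z'` in `hpair` forces `t Z =
  -- 0`.
  obtain ⟨v, hv⟩ : ∃ v : T, v ∉ Submodule.span ℝ {ev Z, σ} := by
    by_contra! hall
    have htop : Submodule.span ℝ {ev Z, σ} = ⊤ := Submodule.eq_top_iff'.2 hall
    have h3 : finrank ℝ T = 3 := by simp [finrank_eq_card_basis e.toBasis]
    classical
    have := finrank_span_finset_le_card (R := ℝ) ({ev Z, σ} : Finset T)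
    rw [Set.finrank, Finset.coe_pair, htop, finrank_top, h3] at this
    have := Finset.card_le_two (a := ev Z) (b := σ)
    omega
  obtain ⟨Z', rfl⟩ := hev v
  obtain ⟨k, hk⟩ := hpair Z Z'
  have ht0 : t Z = 0 := by
    by_contra h0
    apply hv
    rw [Submodule.mem_span_pair]
    refine ⟨(t Z)⁻¹ * t Z', (t Z)⁻¹ * k, ?_⟩
    rw [mul_smul, mul_smul, ← smul_add, ← hk, add_sub_cancel, smul_smul, inv_mul_cancel₀ h0,
      one_smul]
  have := ht Z
  rw [ht0, zero_smul] at this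
  exact sub_eq_zero.1 this

end IsCliffordAction

end Clifford

/-! ### Algebra of the Gauss and Codazzi terms, and the direction of the spinor -/

section ProductTensors

variable {T : Type*} [NormedAddCommGroup T] [InnerProductSpace ℝ T]

/-- The tangential part of the product structure on a single tangent space. -/
def prodVector (χ : T →ₗ[ℝ] T) (ξ : T) (h : ℝ) (V v : T) : T :=
  -h • v + (2 * h * inner ℝ ξ v) • ξ - (inner ℝ ξ v : ℝ) • χ V + (inner ℝ V (χ v) : ℝ) • ξ

/-- The axial vector of the ambient curvature term of the Gauss equation, up to sign. -/
def gaussVector (χ : T →ₗ[ℝ] T) (ξ : T) (c₁ c₂ h : ℝ) (V X Y : T) : T :=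
  (c₁ / 4) • cross χ ξ (X + prodVector χ ξ h V X) (Y + prodVector χ ξ h V Y)
    + (c₂ / 4) • cross χ ξ (X - prodVector χ ξ h V X) (Y - prodVector χ ξ h V Y)

/-- The vector dual to the right-hand side of the Codazzi equation. -/
def codazziVector (χ : T →ₗ[ℝ] T) (ξ : T) (c₁ c₂ h : ℝ) (V X Y : T) : T :=
  (c₁ / 4) • ((inner ℝ V X : ℝ) • (Y + prodVector χ ξ h V Y)
      - (inner ℝ V Y : ℝ) • (X + prodVector χ ξ h V X))
    - (c₂ / 4) • ((inner ℝ V X : ℝ) • (Y - prodVector χ ξ h V Y)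
      - (inner ℝ V Y : ℝ) • (X - prodVector χ ξ h V X))

/-- The value on `(X, Y)` of the 2-form with entries `a`, `b`, `c` in the orthonormal frame `e`. -/
def twoForm (e : OrthonormalBasis (Fin 3) ℝ T) (a b c : ℝ) (X Y : T) : ℝ :=
  a * (inner ℝ (e 0) X * inner ℝ (e 1) Y - inner ℝ (e 1) X * inner ℝ (e 0) Y)
    + b * (inner ℝ (e 0) X * inner ℝ (e 2) Y - inner ℝ (e 2) X * inner ℝ (e 0) Y)
    + c * (inner ℝ (e 1) X * inner ℝ (e 2) Y - inner ℝ (e 2) X * inner ℝ (e 1) Y)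

theorem eq_twoForm_of_alternating (e : OrthonormalBasis (Fin 3) ℝ T) (Θ : T →ₗ[ℝ] T →ₗ[ℝ] ℝ)
    (hΘ : ∀ u v, Θ u v = -Θ v u) (X Y : T) :
    Θ X Y = twoForm e (Θ (e 0) (e 1)) (Θ (e 0) (e 2)) (Θ (e 1) (e 2)) X Y := by
  have hd : ∀ u, Θ u u = 0 := fun u => self_eq_neg.1 (hΘ u u)
  conv_lhs => rw [e.sum_inner_fin_three X, e.sum_inner_fin_three Y]
  simp only [map_add, map_smul, LinearMap.add_apply, LinearMap.smul_apply, smul_eq_mul, hd,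
    hΘ (e 1) (e 0), hΘ (e 2) (e 0), hΘ (e 2) (e 1), twoForm]
  ring

namespace IsRotationFrame

variable {χ : T →ₗ[ℝ] T} {ξ : T} {e : OrthonormalBasis (Fin 3) ℝ T} (hf : IsRotationFrame χ ξ e)
include hf

theorem prodVector_zero (h : ℝ) (V v : T) : inner ℝ (e 0) (prodVector χ ξ h V v) =
    (-h * inner ℝ (e 0) v + inner ℝ (e 2) v * inner ℝ (e 1) V : ℝ) := by
  simp only [prodVector, ← hf.axis, inner_add_right, inner_sub_right, inner_smul_right,
    hf.inner_zero]
  simp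

theorem prodVector_one (h : ℝ) (V v : T) : inner ℝ (e 1) (prodVector χ ξ h V v) =
    (-h * inner ℝ (e 1) v - inner ℝ (e 2) v * inner ℝ (e 0) V : ℝ) := by
  simp only [prodVector, ← hf.axis, inner_add_right, inner_sub_right, inner_smul_right,
    hf.inner_one]
  simp

theorem prodVector_two (h : ℝ) (V v : T) : inner ℝ (e 2) (prodVector χ ξ h V v) =
    (h * inner ℝ (e 2) v + inner ℝ (e 1) V * inner ℝ (e 0) v
      - inner ℝ (e 0) V * inner ℝ (e 1) v : ℝ) := by
  simp only [prodVector, ← hf.axis, inner_add_right, inner_sub_right, inner_smul_right,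
    hf.inner_two, e.inner_fin_three V, hf.inner_zero, hf.inner_one]
  simp
  ring

theorem inner_prodVector_comm (h : ℝ) (V v w : T) :
    inner ℝ (prodVector χ ξ h V v) w = (inner ℝ v (prodVector χ ξ h V w) : ℝ) := by
  simp only [e.inner_fin_three (prodVector χ ξ h V v) w, e.inner_fin_three v, hf.prodVector_zero,
    hf.prodVector_one, hf.prodVector_two]
  ring

/-- The triple product formula; it turns the curvature operators of the Gauss equation into cross
products with an axial vector. -/
theorem wedge_eq_cross (a b z : T) :
    (inner ℝ b z : ℝ) • a - (inner ℝ a z : ℝ) • b = -cross χ ξ (cross χ ξ a b) z := by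
  apply e.eq_of_inner_fin_three <;>
  simp only [hf.cross_zero, hf.cross_one, hf.cross_two, inner_neg_right, inner_sub_right,
    inner_smul_right, e.inner_fin_three a z, e.inner_fin_three b z] <;> ring

/-- The identity `G - K = -Ωξ` of case (1). In each coordinate the two sides differ by `±(c₁ +
c₂)/4` times a 2×2 minor of `(X, Y)` times `h² + |V|² - 1`. -/
theorem gaussVector_sub_codazziVector {c₁ c₂ h : ℝ} {V : T} (hV : inner ℝ (e 2) V = (0 : ℝ))
    (hn : h ^ 2 + inner ℝ V V = 1) (X Y : T) :
    gaussVector χ ξ c₁ c₂ h V X Y - codazziVector χ ξ c₁ c₂ h V X Y =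
      -(twoForm e (c₁ / 2 * (h - 1) - c₂ / 2 * (h + 1)) ((c₁ - c₂) / 2 * inner ℝ V (e 0))
        ((c₁ - c₂) / 2 * inner ℝ V (e 1)) X Y) • ξ := by
  rw [e.inner_fin_three V V, hV] at hn
  rw [real_inner_comm (e 0), real_inner_comm (e 1)]
  obtain rfl := hf.axis
  apply e.eq_of_inner_fin_three <;>
  simp only [gaussVector, codazziVector, inner_add_right, inner_sub_right,
    inner_smul_right, e.inner_fin_three V, hV, twoForm, hf.cross_zero, hf.cross_one, hf.cross_two,
    hf.prodVector_zero, hf.prodVector_one, hf.prodVector_two] <;>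
  simp
  · linear_combination (-(c₁ + c₂) / 4 * (inner ℝ (e 1) X * inner ℝ (e 2) Y
      - inner ℝ (e 2) X * inner ℝ (e 1) Y)) * hn
  · linear_combination ((c₁ + c₂) / 4 * (inner ℝ (e 0) X * inner ℝ (e 2) Y
      - inner ℝ (e 2) X * inner ℝ (e 0) Y)) * hn
  · linear_combination ((c₁ + c₂) / 4 * (inner ℝ (e 0) X * inner ℝ (e 1) Y
      - inner ℝ (e 1) X * inner ℝ (e 0) Y)) * hn

/-- The counterpart `G + K = -Ω(hξ - χV)` for case (2), with the same kind of defect. -/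
theorem gaussVector_add_codazziVector {c₁ c₂ h : ℝ} {V : T} (hV : inner ℝ (e 2) V = (0 : ℝ))
    (hn : h ^ 2 + inner ℝ V V = 1) (X Y : T) :
    gaussVector χ ξ c₁ c₂ h V X Y + codazziVector χ ξ c₁ c₂ h V X Y =
      -(twoForm e (-(c₁ / 2) * (h - 1) - c₂ / 2 * (h + 1)) (-((c₁ + c₂) / 2) * inner ℝ (e 0) V)
        (-((c₁ + c₂) / 2) * inner ℝ (e 1) V) X Y) • (h • ξ - χ V) := by
  rw [e.inner_fin_three V V, hV] at hn
  obtain rfl := hf.axis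
  apply e.eq_of_inner_fin_three <;>
  simp only [gaussVector, codazziVector, inner_add_right, inner_sub_right,
    inner_smul_right, e.inner_fin_three V, hV, twoForm, hf.cross_zero, hf.cross_one, hf.cross_two,
    hf.prodVector_zero, hf.prodVector_one, hf.prodVector_two, hf.inner_zero, hf.inner_one,
    hf.inner_two] <;>
  simp
  · linear_combination (-(c₁ + c₂) / 4 * (inner ℝ (e 1) X * inner ℝ (e 2) Y
      - inner ℝ (e 2) X * inner ℝ (e 1) Y)) * hn
  · linear_combination ((c₁ + c₂) / 4 * (inner ℝ (e 0) X * inner ℝ (e 2) Y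
      - inner ℝ (e 2) X * inner ℝ (e 0) Y)) * hn
  · linear_combination (-(c₁ + c₂) / 4 * (inner ℝ (e 0) X * inner ℝ (e 1) Y
      - inner ℝ (e 1) X * inner ℝ (e 0) Y)) * hn

end IsRotationFrame

namespace IsCliffordAction

variable {W : Type*} [NormedAddCommGroup W] [InnerProductSpace ℂ W]
  {χ : T →ₗ[ℝ] T} {ξ : T} {γ : T → End ℂ W} (hγ : IsCliffordAction χ ξ γ)
  {e : OrthonormalBasis (Fin 3) ℝ T} (hf : IsRotationFrame χ ξ e)

include hγ hf

/-- If `γ(V) s = -i γ(ξ) s + h s`, then `V` is orthogonal to `ξ`, `h² + |V|² = 1`, and `s` is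
the spinor of direction `h ξ - χ V`. -/
theorem direction_of_apply_eq {s : W} (hs : s ≠ 0) {V : T} {h : ℝ}
    (hV : γ V s = -(Complex.I • γ ξ s) + (h : ℂ) • s) :
    inner ℝ (e 2) V = (0 : ℝ) ∧ h ^ 2 + inner ℝ V V = 1 ∧
      γ (h • ξ - χ V) s = -(Complex.I • s) := by
  have hc : cross χ ξ ξ V = χ V := by
    have h1 : χ ξ = 0 := by rw [← hf.axis, hf.two]
    have h2 : ‖ξ‖ = 1 := by rw [← hf.axis]; simp
    simp [cross, h1, h2]
  have hξ : γ ξ (γ ξ s) = -s := by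
    rw [hγ.apply_apply_self hf, ← hf.axis]; simp
  have h1 := LinearMap.congr_fun (hγ.mul ξ V) s
  -- Multiply the hypothesis by `γ(ξ)` and compare with the Clifford relation `γ(ξ)γ(V) = -(ξ,V) +
  -- γ(χV)`.
  rw [hc, Module.End.mul_apply, hV, _root_.map_add, _root_.map_neg, _root_.map_smul,
    _root_.map_smul, hξ] at h1
  simp only [LinearMap.add_apply, LinearMap.smul_apply, Module.End.one_apply] at h1
  have h2 : γ (h • ξ - χ V) s = (-((inner ℝ ξ V : ℝ) : ℂ) - Complex.I) • s := by
    rw [hγ.map_sub, hγ.map_smul, LinearMap.sub_apply, LinearMap.smul_apply,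
      ← sub_eq_iff_eq_add'.2 h1]
    module
  -- The eigenvalue `-(ξ,V) - i` of a skew-Hermitian operator has zero real part.
  have hperp : inner ℝ ξ V = (0 : ℝ) := by
    have hre := hγ.re_inner_apply (h • ξ - χ V) s
    rw [h2, inner_smul_right, inner_self_eq_norm_sq_to_K] at hre
    have hn : ‖s‖ ≠ 0 := norm_ne_zero_iff.2 hs
    have h3 : ((-((inner ℝ ξ V : ℝ) : ℂ) - Complex.I) * ((‖s‖ ^ 2 : ℝ) : ℂ)).re = 0 := by
      rw [Complex.ofReal_pow]
      exact hre
    rw [Complex.re_mul_ofReal] at h3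
    simpa [hn] using h3
  have h3 : γ (h • ξ - χ V) s = -(Complex.I • s) := by
    rw [h2, hperp]; simp
  have hperp' : inner ℝ (e 2) V = (0 : ℝ) := by rw [hf.axis, hperp]
  refine ⟨hperp', ?_, h3⟩
  -- Squaring the eigenvalue `-i` shows that `hξ - χV` is a unit vector, and its squared length is
  -- `h² + |V|²`.
  have h4 := hγ.apply_apply_self hf (h • ξ - χ V) s
  rw [h3, _root_.map_neg, _root_.map_smul, h3, smul_neg, neg_neg, smul_smul, Complex.I_mul_I] at h4
  have h5 := smul_left_injective ℂ hs h4
  have h6 : inner ℝ (h • ξ - χ V) (h • ξ - χ V) = (1 : ℝ) := by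
    exact_mod_cast (neg_injective h5).symm
  rw [e.inner_fin_three, ← hf.axis] at h6
  simp only [inner_sub_right, inner_smul_right, hf.inner_zero, hf.inner_one, hf.inner_two] at h6
  rw [e.inner_fin_three V V, hperp']
  simp at h6
  linarith

end IsCliffordAction

end ProductTensors

/-! ### Smooth vector fields, constancy of functions and curvature on manifolds -/

section Manifolds

variable {E : Type*} [NormedAddCommGroup E] [NormedSpace ℝ E] [FiniteDimensional ℝ E]
  {M : Type*} [TopologicalSpace M] [ChartedSpace E M] [IsManifold 𝓘(ℝ, E) ∞ M]

open scoped Topology in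
-- A local extension is cut off by a bump function. This passes from identities between global
-- fields to identities on one tangent space.
theorem exists_smoothField_apply_eq [T2Space M] (x : M) (v : TangentSpace 𝓘(ℝ, E) x) :
    ∃ X : ∀ x : M, TangentSpace 𝓘(ℝ, E) x, SmoothField X ∧ X x = v := by
  obtain ⟨s, hs, hsmooth⟩ := FiberBundle.exists_contMDiffOn_extend (k := ∞) 𝓘(ℝ, E) E v
  have hi : interior s ∈ 𝓝 x := interior_mem_nhds.2 hs
  obtain ⟨f, hf, -⟩ := (SmoothBumpFunction.nhds_basis_support (I := 𝓘(ℝ, E)) hi).mem_iff.1 hi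
  refine ⟨(f : M → ℝ) • FiberBundle.extend E v, ?_, ?_⟩
  · exact ContMDiffOn.smul_section_of_tsupport f.contMDiff.contMDiffOn isOpen_interior hf
      (hsmooth.mono interior_subset)
  · simp

/-- On a ball in a chart the derivative vanishes, so `f` is locally constant; connectedness does the
rest. -/
theorem eq_of_mfderiv_eq_zero [PreconnectedSpace M] {G : Type*} [NormedAddCommGroup G]
    [NormedSpace ℝ G] {f : M → G}
    (hf : MDifferentiable 𝓘(ℝ, E) 𝓘(ℝ, G) f) (hf' : ∀ x, mfderiv 𝓘(ℝ, E) 𝓘(ℝ, G) f x = 0)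
    (x y : M) : f x = f y := by
  have hloc : IsLocallyConstant f := by
    rw [IsLocallyConstant.iff_exists_open]
    intro x
    set c := extChartAt 𝓘(ℝ, E) x
    have ht : IsOpen c.target := isOpen_extChartAt_target x
    obtain ⟨r, hr, hball⟩ := Metric.isOpen_iff.1 ht (c x) (mem_extChartAt_target x)
    have hsymm : ∀ z ∈ c.target, MDifferentiableAt 𝓘(ℝ, E) 𝓘(ℝ, E) c.symm z := fun z hz =>
      ((contMDiffOn_extChartAt_symm (n := ∞) x).contMDiffAt (ht.mem_nhds hz)).mdifferentiableAt
        (by simp)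
    have hd : ∀ z ∈ Metric.ball (c x) r, HasFDerivAt (f ∘ c.symm) (0 : E →L[ℝ] G) z := by
      intro z hz
      have := (hf (c.symm z)).hasMFDerivAt.comp z (hsymm z (hball hz)).hasMFDerivAt
      rw [hf', ContinuousLinearMap.zero_comp] at this
      exact hasMFDerivAt_iff_hasFDerivAt.1 this
    have hconst := fun z (hz : z ∈ Metric.ball (c x) r) =>
      Metric.isOpen_ball.is_const_of_fderiv_eq_zero (𝕜 := ℝ) (f := f ∘ c.symm)
        (convex_ball (c x) r).isPreconnected
        (fun w hw => (hd w hw).differentiableAt.differentiableWithinAt)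
        (fun w hw => (hd w hw).fderiv) hz (Metric.mem_ball_self hr)
    refine ⟨c.source ∩ c ⁻¹' Metric.ball (c x) r,
      (continuousOn_extChartAt x).isOpen_inter_preimage (isOpen_extChartAt_source x)
        Metric.isOpen_ball, ⟨mem_extChartAt_source x, Metric.mem_ball_self hr⟩, ?_⟩
    rintro y ⟨hy, hyb⟩
    have := hconst (c y) hyb
    rwa [Function.comp, Function.comp, c.left_inv hy, c.left_inv (mem_extChartAt_source x)] at this
  exact hloc.apply_eq_of_isPreconnected isPreconnected_univ (Set.mem_univ x) (Set.mem_univ y)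

theorem SmoothField.mdifferentiableAt {X : ∀ x : M, TangentSpace 𝓘(ℝ, E) x} (hX : SmoothField X)
    (x : M) :
    MDifferentiableAt 𝓘(ℝ, E) (𝓘(ℝ, E).prod 𝓘(ℝ, E)) (fun y => TotalSpace.mk' E y (X y)) x :=
  (ContMDiff.contMDiffAt hX).mdifferentiableAt (by simp)

theorem SmoothEndo.smoothField_apply
    {A : ∀ x : M, TangentSpace 𝓘(ℝ, E) x →L[ℝ] TangentSpace 𝓘(ℝ, E) x} (hA : SmoothEndo A)
    {X : ∀ x : M, TangentSpace 𝓘(ℝ, E) x} (hX : SmoothField X) :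
    SmoothField fun x => A x (X x) :=
  ContMDiff.clm_bundle_apply (b := fun x : M => x) hA hX

theorem SmoothField.cov
    {cov : CovariantDerivative 𝓘(ℝ, E) E (TangentSpace 𝓘(ℝ, E) : M → Type _)}
    (hcov : CovariantDerivative.ContMDiffCovariantDerivative cov ∞)
    {X Y : ∀ x : M, TangentSpace 𝓘(ℝ, E) x} (hX : SmoothField X) (hY : SmoothField Y) :
    SmoothField fun x => cov X x (Y x) := by
  have h := hcov.contMDiff.contMDiff (σ := X) (by simpa using ContMDiff.contMDiffOn hX)
  rw [contMDiffOn_univ] at h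
  exact ContMDiff.clm_bundle_apply (b := fun x : M => x) h hY

theorem curvature_swap {F : Type*} [NormedAddCommGroup F] [NormedSpace ℝ F]
    {W : M → Type*} [TopologicalSpace (TotalSpace F W)]
    [∀ x, AddCommGroup (W x)] [∀ x, Module ℝ (W x)] [∀ x, TopologicalSpace (W x)]
    [∀ x, IsTopologicalAddGroup (W x)] [∀ x, ContinuousSMul ℝ (W x)] [FiberBundle F W]
    (cov : CovariantDerivative 𝓘(ℝ, E) F W)
    (X Y : ∀ x : M, TangentSpace 𝓘(ℝ, E) x) (σ : ∀ x : M, W x) (x : M) :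
    curvature cov X Y σ x = -curvature cov Y X σ x := by
  simp only [curvature, VectorField.mlieBracket_swap_apply (V := X) (W := Y), map_neg]
  abel

end Manifolds

/-! ### Curvature of the spinorial connection and generalized Killing spinors -/

section Spinors

variable {E : Type*} [NormedAddCommGroup E] [NormedSpace ℝ E] [FiniteDimensional ℝ E]
  {M : Type*} [TopologicalSpace M] [ChartedSpace E M] [IsManifold 𝓘(ℝ, E) ∞ M]
  [RiemannianBundle (fun x : M => TangentSpace 𝓘(ℝ, E) x)]
  [IsContMDiffRiemannianBundle 𝓘(ℝ, E) ∞ E (fun x : M => TangentSpace 𝓘(ℝ, E) x)]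
  {cov : CovariantDerivative 𝓘(ℝ, E) E (TangentSpace 𝓘(ℝ, E) : M → Type _)}
  {o : ∀ x : M, Orientation ℝ (TangentSpace 𝓘(ℝ, E) x) (Fin 3)}
  {F : Type*} [NormedAddCommGroup F] [NormedSpace ℂ F] [FiniteDimensional ℂ F]
  {S : M → Type*} [TopologicalSpace (TotalSpace F S)]
  [∀ x, NormedAddCommGroup (S x)] [∀ x, InnerProductSpace ℂ (S x)]
  [FiberBundle F S] [VectorBundle ℂ F S] [VectorBundle ℝ F S]
  [ContMDiffVectorBundle ∞ F S 𝓘(ℝ, E)]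
  [IsContMDiffRiemannianBundle 𝓘(ℝ, E) ∞ F S]
  (P : SpincStructure cov o (F := F) S)

theorem SmoothSpinor.mdifferentiableAt {σ : ∀ x : M, S x} (hσ : SmoothSpinor E F σ) (x : M) :
    MDifferentiableAt 𝓘(ℝ, E) (𝓘(ℝ, E).prod 𝓘(ℝ, F)) (fun y => TotalSpace.mk' F y (σ y)) x :=
  (ContMDiff.contMDiffAt hσ).mdifferentiableAt (by simp)

namespace SpincStructure

theorem smoothSpinor_γ {X : ∀ x : M, TangentSpace 𝓘(ℝ, E) x} (hX : SmoothField X)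
    {σ : ∀ x : M, S x} (hσ : SmoothSpinor E F σ) :
    SmoothSpinor E F fun x => P.γ x (X x) (σ x) :=
  ContMDiff.clm_bundle_apply₂ (b := fun x : M => x) P.smooth_γ hX hσ

/-- Differentiate the Leibniz rule for `γ` twice; the mixed first-order terms are symmetric in `X`,
`Y` and cancel. -/
theorem curvature_conn_γ (hcov : IsLeviCivita cov) {X Y Z : ∀ x : M, TangentSpace 𝓘(ℝ, E) x}
    (hX : SmoothField X) (hY : SmoothField Y) (hZ : SmoothField Z) {σ : ∀ x : M, S x}
    (hσ : SmoothSpinor E F σ) (hσX : SmoothSpinor E F fun x => P.conn σ x (X x))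
    (hσY : SmoothSpinor E F fun x => P.conn σ x (Y x)) (x : M) :
    curvature P.conn X Y (fun y => P.γ y (Z y) (σ y)) x =
      P.γ x (curvature cov X Y Z x) (σ x) + P.γ x (Z x) (curvature P.conn X Y σ x) := by
  have h1 : ∀ W : ∀ x : M, TangentSpace 𝓘(ℝ, E) x,
      (fun y => P.conn (fun y => P.γ y (Z y) (σ y)) y (W y)) =
        (fun y => P.γ y (cov Z y (W y)) (σ y)) + fun y => P.γ y (Z y) (P.conn σ y (W y)) := by
    intro W
    funext y
    exact P.conn_γ y Z σ (W y) (hZ.mdifferentiableAt y) (hσ.mdifferentiableAt y)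
  have h2 : ∀ W W' : ∀ x : M, TangentSpace 𝓘(ℝ, E) x, SmoothField W →
      SmoothSpinor E F (fun x => P.conn σ x (W x)) →
      P.conn (fun y => P.conn (fun y => P.γ y (Z y) (σ y)) y (W y)) x (W' x) =
        P.γ x (cov (fun y => cov Z y (W y)) x (W' x)) (σ x)
          + P.γ x (cov Z x (W x)) (P.conn σ x (W' x))
          + (P.γ x (cov Z x (W' x)) (P.conn σ x (W x))
          + P.γ x (Z x) (P.conn (fun y => P.conn σ y (W y)) x (W' x))) := by
    intro W W' hW hσW
    have hZW := hZ.cov hcov.smooth hW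
    rw [h1, P.conn.isCovariantDerivativeOnUniv.add
      ((P.smoothSpinor_γ hZW hσ).mdifferentiableAt x)
      ((P.smoothSpinor_γ hZ hσW).mdifferentiableAt x), _root_.add_apply,
      P.conn_γ x _ σ _ (hZW.mdifferentiableAt x) (hσ.mdifferentiableAt x),
      P.conn_γ x Z _ _ (hZ.mdifferentiableAt x) (hσW.mdifferentiableAt x)]
  rw [curvature, h2 Y X hY hσY, h2 X Y hX hσX,
    P.conn_γ x Z σ _ (hZ.mdifferentiableAt x) (hσ.mdifferentiableAt x)]
  simp only [curvature, map_sub, _root_.sub_apply]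
  abel

theorem smoothSpinor_conn_killing
    {A : ∀ x : M, TangentSpace 𝓘(ℝ, E) x →L[ℝ] TangentSpace 𝓘(ℝ, E) x} (hA : SmoothEndo A)
    {φ : ∀ x : M, S x} (hφ : SmoothSpinor E F φ) {κ : ℝ}
    (hκ : ∀ x v, P.conn φ x v = κ • P.γ x (A x v) (φ x))
    {X : ∀ x : M, TangentSpace 𝓘(ℝ, E) x} (hX : SmoothField X) :
    SmoothSpinor E F fun x => P.conn φ x (X x) := by
  simp only [hκ]
  exact ContMDiff.const_smul_section (P.smoothSpinor_γ (hA.smoothField_apply hX) hφ)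

/-- In `∇_X(κ γ(AY)φ)` the derivative of `φ` puts `γ(AX)` to the right of `γ(AY)`, hence the
reversed order in the quadratic term. -/
theorem curvature_conn_killing (hcov : IsLeviCivita cov)
    {A : ∀ x : M, TangentSpace 𝓘(ℝ, E) x →L[ℝ] TangentSpace 𝓘(ℝ, E) x} (hA : SmoothEndo A)
    {φ : ∀ x : M, S x} (hφ : SmoothSpinor E F φ) {κ : ℝ}
    (hκ : ∀ x v, P.conn φ x v = κ • P.γ x (A x v) (φ x))
    {X Y : ∀ x : M, TangentSpace 𝓘(ℝ, E) x} (hX : SmoothField X) (hY : SmoothField Y) (x : M) :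
    curvature P.conn X Y φ x = κ • P.γ x (dNabla cov A X Y x) (φ x)
      + κ ^ 2 • (P.γ x (A x (Y x)) (P.γ x (A x (X x)) (φ x))
        - P.γ x (A x (X x)) (P.γ x (A x (Y x)) (φ x))) := by
  have h2 : ∀ W W' : ∀ x : M, TangentSpace 𝓘(ℝ, E) x, SmoothField W →
      P.conn (fun y => P.conn φ y (W y)) x (W' x) =
        κ • P.γ x (cov (fun y => A y (W y)) x (W' x)) (φ x)
          + κ ^ 2 • P.γ x (A x (W x)) (P.γ x (A x (W' x)) (φ x)) := by
    intro W W' hW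
    have h1 : (fun y => P.conn φ y (W y)) = κ • fun y => P.γ y (A y (W y)) (φ y) :=
      funext fun y => hκ y (W y)
    have hAW := hA.smoothField_apply hW
    rw [h1, P.conn.isCovariantDerivativeOnUniv.smul_const κ
      ((P.smoothSpinor_γ hAW hφ).mdifferentiableAt x), _root_.smul_apply,
      P.conn_γ x _ φ _ (hAW.mdifferentiableAt x) (hφ.mdifferentiableAt x), hκ, map_smul]
    module
  -- Vanishing torsion replaces `[X, Y]` by `∇_X Y - ∇_Y X`, which assembles the first-order terms
  -- into `d^∇A`.
  have htor := cov.torsion_eq_zero_iff.1 hcov.torsion_free (hX.mdifferentiableAt x)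
    (hY.mdifferentiableAt x)
  rw [curvature, h2 Y X hY, h2 X Y hX, hκ, ← htor]
  simp only [dNabla, map_sub, _root_.sub_apply]
  module

/-- Clifford multiplication is skew and `κ` is real, so `|φ|²` has zero derivative and is constant.
-/
theorem ne_zero_of_killing [PreconnectedSpace M]
    {A : ∀ x : M, TangentSpace 𝓘(ℝ, E) x →L[ℝ] TangentSpace 𝓘(ℝ, E) x}
    {φ : ∀ x : M, S x} (hφ : SmoothSpinor E F φ) {κ : ℝ}
    (hκ : ∀ x v, P.conn φ x v = κ • P.γ x (A x v) (φ x)) (hφ0 : φ ≠ 0) (x : M) : φ x ≠ 0 := by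
  have hre : ∀ x v, inner ℝ (P.γ x v (φ x)) (φ x) = (0 : ℝ) := fun x v => by
    have h := congrArg Complex.re (P.γ_skew x v (φ x) (φ x))
    rw [← inner_conj_symm (φ x), Complex.neg_re, Complex.conj_re] at h
    have : (inner ℂ (P.γ x v (φ x)) (φ x)).re = 0 := by linarith
    exact this
  have hd : MDifferentiable 𝓘(ℝ, E) 𝓘(ℝ, ℝ) fun y => (inner ℝ (φ y) (φ y) : ℝ) := fun y =>
    (hφ.mdifferentiableAt y).inner_bundle (hφ.mdifferentiableAt y)
  have h0 : ∀ y, mfderiv 𝓘(ℝ, E) 𝓘(ℝ, ℝ) (fun y => (inner ℝ (φ y) (φ y) : ℝ)) y = 0 := by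
    intro y
    ext v
    have h := P.conn_metric.mvfderiv_inner_eq (FiberBundle.extend E v) (hφ.mdifferentiableAt y)
      (hφ.mdifferentiableAt y)
    simp only [hκ, real_inner_comm _ (φ y), inner_smul_left, hre, mul_zero, add_zero,
      FiberBundle.extend_apply_self] at h
    exact h
  obtain ⟨z, hz⟩ := Function.ne_iff.1 hφ0
  intro hx
  have h := eq_of_mfderiv_eq_zero hd h0 z x
  rw [hx, inner_zero_left] at h
  exact hz (inner_self_eq_zero.1 h)

end SpincStructure

end Spinors

/-- Polarizing the squares gives anticommutation, and the volume condition gives `γ(e₁)γ(e₂) =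
γ(e₃)` and its cyclic analogues. These products determine `γ(u)γ(v)` by bilinearity. -/
theorem IsCliffordAction.of_volume {T : Type*} [NormedAddCommGroup T] [InnerProductSpace ℝ T]
    {W : Type*} [NormedAddCommGroup W] [InnerProductSpace ℂ W] {χ : T →ₗ[ℝ] T} {ξ : T}
    {e : OrthonormalBasis (Fin 3) ℝ T} (hf : IsRotationFrame χ ξ e) {γ : T → End ℂ W}
    (map_add : ∀ u v, γ (u + v) = γ u + γ v) (map_smul : ∀ (r : ℝ) u, γ (r • u) = (r : ℂ) • γ u)
    (sq : ∀ v, γ v * γ v = -((inner ℝ v v : ℝ) : ℂ) • 1)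
    (volume : -(γ (e 0) * (γ (e 1) * γ (e 2))) = 1)
    (skew : ∀ v s t, inner ℂ (γ v s) t = -inner ℂ s (γ v t)) : IsCliffordAction χ ξ γ := by
  refine ⟨map_add, map_smul, ?_, skew⟩
  have hsq : ∀ i, γ (e i) * γ (e i) = -1 := fun i => by simp [sq]
  have hanti : ∀ i j, i ≠ j → γ (e i) * γ (e j) = -(γ (e j) * γ (e i)) := fun i j hij => by
    have h := sq (e i + e j)
    rw [map_add, add_mul, mul_add, mul_add, hsq, hsq] at h
    have h2 : inner ℝ (e i + e j) (e i + e j) = (2 : ℝ) := by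
      simp only [inner_add_left, inner_add_right, OrthonormalBasis.inner_eq_ite, hij, hij.symm,
        if_true, if_false]
      norm_num
    rw [h2] at h
    have h3 : γ (e i) * γ (e j) + γ (e j) * γ (e i) = 0 := by
      have : (-((2 : ℝ) : ℂ)) • (1 : End ℂ W) = -1 + -1 := by push_cast; module
      rw [this] at h
      rw [← sub_eq_zero] at h
      refine Eq.trans ?_ h
      abel
    exact eq_neg_of_add_eq_zero_left h3
  have h01 : γ (e 0) * γ (e 1) = γ (e 2) := by
    calc γ (e 0) * γ (e 1) = -(γ (e 0) * (γ (e 1) * γ (e 2))) * γ (e 2) := by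
          rw [neg_mul, mul_assoc, mul_assoc, hsq]; simp
      _ = γ (e 2) := by rw [volume, one_mul]
  have h12 : γ (e 1) * γ (e 2) = γ (e 0) := by
    calc γ (e 1) * γ (e 2) = γ (e 0) * -(γ (e 0) * (γ (e 1) * γ (e 2))) := by
          rw [mul_neg, ← mul_assoc (γ (e 0)), hsq]; simp
      _ = γ (e 0) := by rw [volume, mul_one]
  have h20 : γ (e 2) * γ (e 0) = γ (e 1) := by
    rw [← h01, mul_assoc, hanti 1 0 (by decide), mul_neg, ← mul_assoc, hsq]; simp
  have h10 : γ (e 1) * γ (e 0) = -γ (e 2) := by rw [hanti 1 0 (by decide), h01]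
  have h21 : γ (e 2) * γ (e 1) = -γ (e 0) := by rw [hanti 2 1 (by decide), h12]
  have h02 : γ (e 0) * γ (e 2) = -γ (e 1) := by rw [hanti 0 2 (by decide), h20]
  intro u v
  have hexp : ∀ w, γ w = ((inner ℝ (e 0) w : ℝ) : ℂ) • γ (e 0)
      + ((inner ℝ (e 1) w : ℝ) : ℂ) • γ (e 1) + ((inner ℝ (e 2) w : ℝ) : ℂ) • γ (e 2) := fun w => by
    conv_lhs => rw [e.sum_inner_fin_three w]
    simp only [map_add, map_smul]
  rw [hexp (cross χ ξ u v), hexp u, hexp v, hf.cross_zero, hf.cross_one, hf.cross_two,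
    e.inner_fin_three u v]
  simp only [add_mul, mul_add, smul_mul_smul_comm, hsq, h01, h12, h20, h10, h21, h02]
  push_cast
  module

/-! ### Reduction to cross products and the equivalence of Gauss and Codazzi -/

section Main

variable {E : Type*} [NormedAddCommGroup E] [NormedSpace ℝ E] [FiniteDimensional ℝ E]
  {M : Type*} [TopologicalSpace M] [ChartedSpace E M] [IsManifold 𝓘(ℝ, E) ∞ M]
  [RiemannianBundle (fun x : M => TangentSpace 𝓘(ℝ, E) x)]
  [IsContMDiffRiemannianBundle 𝓘(ℝ, E) ∞ E (fun x : M => TangentSpace 𝓘(ℝ, E) x)]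

namespace AlmostContact

variable (C : AlmostContact (E := E) M)

theorem exists_isAdapted (hE : finrank ℝ E = 3) (x : M) :
    ∃ e : OrthonormalBasis (Fin 3) ℝ (TangentSpace 𝓘(ℝ, E) x), C.IsAdapted e :=
  exists_orthonormalBasis_of_contact (T := TangentSpace 𝓘(ℝ, E) x)
    (χ := (C.χ x : TangentSpace 𝓘(ℝ, E) x →ₗ[ℝ] TangentSpace 𝓘(ℝ, E) x)) hE
    (C.χ_sq x) (C.unit_ξ x) (C.χ_ξ x) (C.compatible x)

theorem IsAdapted.isRotationFrame {C : AlmostContact (E := E) M} {x : M}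
    {e : OrthonormalBasis (Fin 3) ℝ (TangentSpace 𝓘(ℝ, E) x)} (he : C.IsAdapted e) :
    IsRotationFrame (C.χ x : TangentSpace 𝓘(ℝ, E) x →ₗ[ℝ] TangentSpace 𝓘(ℝ, E) x) (C.ξ x) e :=
  isRotationFrame_of_adapted (C.χ_sq x) (C.χ_ξ x) e he.1 he.2

theorem prodEndo_eq (h : M → ℝ) (V : ∀ x : M, TangentSpace 𝓘(ℝ, E) x) (x : M)
    (v : TangentSpace 𝓘(ℝ, E) x) : C.prodEndo h V x v =
      prodVector (C.χ x : TangentSpace 𝓘(ℝ, E) x →ₗ[ℝ] TangentSpace 𝓘(ℝ, E) x) (C.ξ x)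
        (h x) (V x) v :=
  rfl

end AlmostContact

theorem dNabla_swap (cov : CovariantDerivative 𝓘(ℝ, E) E (TangentSpace 𝓘(ℝ, E) : M → Type _))
    (A : ∀ x : M, TangentSpace 𝓘(ℝ, E) x →L[ℝ] TangentSpace 𝓘(ℝ, E) x)
    (X Y : ∀ x : M, TangentSpace 𝓘(ℝ, E) x) (x : M) :
    dNabla cov A X Y x = -dNabla cov A Y X x := by
  simp only [dNabla, neg_sub]

theorem gaussEquation_iff {C : AlmostContact (E := E) M}
    (he : ∀ x : M, ∃ e : OrthonormalBasis (Fin 3) ℝ (TangentSpace 𝓘(ℝ, E) x), C.IsAdapted e)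
    (cov : CovariantDerivative 𝓘(ℝ, E) E (TangentSpace 𝓘(ℝ, E) : M → Type _)) (c₁ c₂ : ℝ)
    (A : ∀ x : M, TangentSpace 𝓘(ℝ, E) x →L[ℝ] TangentSpace 𝓘(ℝ, E) x)
    (V : ∀ x : M, TangentSpace 𝓘(ℝ, E) x) (h : M → ℝ) :
    GaussEquation cov C c₁ c₂ A V h ↔
      ∀ X Y Z : ∀ x : M, TangentSpace 𝓘(ℝ, E) x,
        SmoothField X → SmoothField Y → SmoothField Z → ∀ x : M,
        curvature cov X Y Z x =
          -cross (C.χ x : TangentSpace 𝓘(ℝ, E) x →ₗ[ℝ] TangentSpace 𝓘(ℝ, E) x) (C.ξ x)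
            (gaussVector (C.χ x : TangentSpace 𝓘(ℝ, E) x →ₗ[ℝ] TangentSpace 𝓘(ℝ, E) x) (C.ξ x)
              c₁ c₂ (h x) (V x) (X x) (Y x)
            + cross (C.χ x : TangentSpace 𝓘(ℝ, E) x →ₗ[ℝ] TangentSpace 𝓘(ℝ, E) x) (C.ξ x)
              (A x (X x)) (A x (Y x))) (Z x) := by
  unfold GaussEquation
  refine forall₃_congr fun X Y Z => forall₄_congr fun _ _ _ x => ?_
  obtain ⟨e, he⟩ := he x
  have hf := he.isRotationFrame
  have hrw : ∀ a b z : TangentSpace 𝓘(ℝ, E) x, wedge a b z = -cross (C.χ x) (C.ξ x)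
      (cross (C.χ x) (C.ξ x) a b) z := fun a b z => hf.wedge_eq_cross a b z
  have hlin : ∀ p q r z : TangentSpace 𝓘(ℝ, E) x,
      cross (C.χ x : TangentSpace 𝓘(ℝ, E) x →ₗ[ℝ] TangentSpace 𝓘(ℝ, E) x) (C.ξ x)
        ((c₁ / 4) • p + (c₂ / 4) • q + r) z = (c₁ / 4) • cross (C.χ x) (C.ξ x) p z
          + (c₂ / 4) • cross (C.χ x) (C.ξ x) q z + cross (C.χ x) (C.ξ x) r z := fun p q r z => by
    rw [cross_add_left, cross_add_left, cross_smul_left, cross_smul_left]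
  rw [hrw, hrw, hf.wedge_eq_cross, gaussVector, hlin]
  simp only [C.prodEndo_eq]
  refine Eq.congr_right ?_
  module

theorem codazziEquation_iff [T2Space M] {C : AlmostContact (E := E) M}
    (he : ∀ x : M, ∃ e : OrthonormalBasis (Fin 3) ℝ (TangentSpace 𝓘(ℝ, E) x), C.IsAdapted e)
    (cov : CovariantDerivative 𝓘(ℝ, E) E (TangentSpace 𝓘(ℝ, E) : M → Type _)) (c₁ c₂ : ℝ)
    (A : ∀ x : M, TangentSpace 𝓘(ℝ, E) x →L[ℝ] TangentSpace 𝓘(ℝ, E) x)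
    (V : ∀ x : M, TangentSpace 𝓘(ℝ, E) x) (h : M → ℝ) :
    CodazziEquation cov C c₁ c₂ A V h ↔
      ∀ X Y : ∀ x : M, TangentSpace 𝓘(ℝ, E) x, SmoothField X → SmoothField Y → ∀ x : M,
        dNabla cov A X Y x =
          codazziVector (C.χ x : TangentSpace 𝓘(ℝ, E) x →ₗ[ℝ] TangentSpace 𝓘(ℝ, E) x) (C.ξ x)
            c₁ c₂ (h x) (V x) (X x) (Y x) := by
  have key : CodazziEquation cov C c₁ c₂ A V h ↔
      ∀ X Y Z : ∀ x : M, TangentSpace 𝓘(ℝ, E) x,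
        SmoothField X → SmoothField Y → SmoothField Z → ∀ x : M,
        inner ℝ (dNabla cov A X Y x) (Z x) = (inner ℝ
          (codazziVector (C.χ x : TangentSpace 𝓘(ℝ, E) x →ₗ[ℝ] TangentSpace 𝓘(ℝ, E) x) (C.ξ x)
            c₁ c₂ (h x) (V x) (X x) (Y x)) (Z x) : ℝ) := by
    unfold CodazziEquation
    refine forall₃_congr fun X Y Z => forall₄_congr fun _ _ _ x => ?_
    obtain ⟨e, he⟩ := he x
    have hf := he.isRotationFrame
    refine Eq.congr_right ?_
    -- Symmetry of `f` moves it off `Z` in the `c₂` terms.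
    simp only [C.prodEndo_eq, ← hf.inner_prodVector_comm, codazziVector, inner_add_left,
      inner_sub_left, inner_smul_left, real_inner_comm (V x) (Y x)]
    simp
    ring
  rw [key]
  constructor
  · intro H X Y hX hY x
    refine ext_inner_right ℝ fun v => ?_
    obtain ⟨Z, hZ, rfl⟩ := exists_smoothField_apply_eq x v
    exact H X Y Z hX hY hZ x
  · intro H X Y Z hX hY _ x
    rw [H X Y hX hY x]

variable {cov : CovariantDerivative 𝓘(ℝ, E) E (TangentSpace 𝓘(ℝ, E) : M → Type _)}
  {o : ∀ x : M, Orientation ℝ (TangentSpace 𝓘(ℝ, E) x) (Fin 3)}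
  {F : Type*} [NormedAddCommGroup F] [NormedSpace ℂ F] [FiniteDimensional ℂ F]
  {S : M → Type*} [TopologicalSpace (TotalSpace F S)]
  [∀ x, NormedAddCommGroup (S x)] [∀ x, InnerProductSpace ℂ (S x)]
  [FiberBundle F S] [VectorBundle ℂ F S] [VectorBundle ℝ F S]
  [ContMDiffVectorBundle ∞ F S 𝓘(ℝ, E)]
  [IsContMDiffRiemannianBundle 𝓘(ℝ, E) ∞ F S]
  (P : SpincStructure cov o (F := F) S)

namespace SpincStructure

/-- Clifford multiplication by a tangent vector as a complex linear endomorphism. -/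
def γEnd (x : M) (v : TangentSpace 𝓘(ℝ, E) x) : End ℂ (S x) where
  toFun := P.γ x v
  map_add' := (P.γ x v).map_add
  map_smul' := P.γ_complex x v

theorem γEnd_apply (x : M) (v : TangentSpace 𝓘(ℝ, E) x) (s : S x) : P.γEnd x v s = P.γ x v s := rfl

theorem isCliffordAction {C : AlmostContact (E := E) M} (ho : C.IsOriented o) {x : M}
    {e : OrthonormalBasis (Fin 3) ℝ (TangentSpace 𝓘(ℝ, E) x)} (he : C.IsAdapted e) :
    IsCliffordAction (C.χ x : TangentSpace 𝓘(ℝ, E) x →ₗ[ℝ] TangentSpace 𝓘(ℝ, E) x) (C.ξ x)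
      (P.γEnd x) := by
  refine IsCliffordAction.of_volume he.isRotationFrame ?_ ?_ ?_ ?_ (P.γ_skew x)
  · intro u v
    ext s
    simp [γEnd_apply]
  · intro r u
    ext s
    simp [γEnd_apply]
  · intro v
    ext s
    simp only [Module.End.mul_apply, γEnd_apply, P.γ_sq, neg_smul]
    rfl
  · ext s
    exact P.volume x e (ho x e he) s

theorem finrank_fiber (P : SpincStructure cov o (F := F) S) (x : M) : finrank ℂ (S x) = 2 := by
  rw [← P.rank_two]
  exact ((trivializationAt F S x).continuousLinearEquivAt ℂ x
    (FiberBundle.mem_baseSet_trivializationAt' x)).toLinearEquiv.finrank_eq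

omit P in
theorem areaForm_of_detWedge {x : M} (b : Basis (Fin 2) ℂ (S x)) {s t s' t' a c : S x} {z : ℂ}
    (h : detWedge s t + detWedge s' t' = z • detWedge a c) :
    areaForm b s t + areaForm b s' t' = z * areaForm b a c := by
  have := congrArg (exteriorPower.alternatingMapLinearEquiv b.det) h
  simpa [detWedge, exteriorPower.alternatingMapLinearEquiv_apply_ιMulti, ← areaForm_eq_det]
    using this

/-- The curvature of the Levi-Civita connection in terms of a generalized Killing spinor. -/
theorem curvature_eq_cross [T2Space M] (hcov : IsLeviCivita cov)
    {C : AlmostContact (E := E) M} (ho : C.IsOriented o)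
    {Ω : ∀ x : M, TangentSpace 𝓘(ℝ, E) x →L[ℝ] TangentSpace 𝓘(ℝ, E) x →L[ℝ] ℝ}
    (hΩ : P.IsAuxiliaryCurvature Ω)
    {A : ∀ x : M, TangentSpace 𝓘(ℝ, E) x →L[ℝ] TangentSpace 𝓘(ℝ, E) x} (hA : SmoothEndo A)
    {φ : ∀ x : M, S x} (hφ : SmoothSpinor E F φ) {ε : ℝ} (hε : ε ^ 2 = 1)
    (hκ : ∀ x v, P.conn φ x v = (ε / 2) • P.γ x (A x v) (φ x))
    {x : M} (hx : φ x ≠ 0) {σ : TangentSpace 𝓘(ℝ, E) x}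
    (hσ : P.γ x σ (φ x) = -(Complex.I • φ x))
    {e : OrthonormalBasis (Fin 3) ℝ (TangentSpace 𝓘(ℝ, E) x)} (he : C.IsAdapted e)
    {X Y Z : ∀ x : M, TangentSpace 𝓘(ℝ, E) x}
    (hX : SmoothField X) (hY : SmoothField Y) (hZ : SmoothField Z) :
    curvature cov X Y Z x =
      cross (C.χ x : TangentSpace 𝓘(ℝ, E) x →ₗ[ℝ] TangentSpace 𝓘(ℝ, E) x) (C.ξ x)
        (ε • dNabla cov A X Y x
          - cross (C.χ x : TangentSpace 𝓘(ℝ, E) x →ₗ[ℝ] TangentSpace 𝓘(ℝ, E) x) (C.ξ x)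
            (A x (X x)) (A x (Y x))
          + Ω x (X x) (Y x) • σ) (Z x) := by
  have hf := he.isRotationFrame
  have hγ := P.isCliffordAction ho he
  set χ := (C.χ x : TangentSpace 𝓘(ℝ, E) x →ₗ[ℝ] TangentSpace 𝓘(ℝ, E) x)
  set u : TangentSpace 𝓘(ℝ, E) x := (ε / 2) • dNabla cov A X Y x
    + (-1 / 2 : ℝ) • cross χ (C.ξ x) (A x (X x)) (A x (Y x)) with hu
  have hR : curvature P.conn X Y φ x = P.γ x u (φ x) := by
    rw [P.curvature_conn_killing hcov hA hφ hκ hX hY]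
    have h1 := LinearMap.congr_fun (hγ.commutator hf (A x (X x)) (A x (Y x))) (φ x)
    simp only [LinearMap.sub_apply, Module.End.mul_apply, LinearMap.smul_apply, γEnd_apply] at h1
    -- The factor `1/4` times the reversed commutator `-2 γ(AX × AY)` gives the coefficient `-1/2`
    -- in `u`.
    have h2 : (ε / 2) ^ 2 = 1 / 4 := by rw [div_pow, hε]; norm_num
    rw [← neg_sub, h1, h2, hu, map_add, map_smul, map_smul, _root_.add_apply, _root_.smul_apply,
      _root_.smul_apply]
    module
  have hRZ : ∀ Z : ∀ x : M, TangentSpace 𝓘(ℝ, E) x, SmoothField Z →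
      curvature P.conn X Y (fun y => P.γ y (Z y) (φ y)) x =
        P.γ x (curvature cov X Y Z x) (φ x) + P.γ x (Z x) (P.γ x u (φ x)) := fun Z hZ => by
    rw [P.curvature_conn_γ hcov hX hY hZ hφ (P.smoothSpinor_conn_killing hA hφ hκ hX)
      (P.smoothSpinor_conn_killing hA hφ hκ hY), hR]
  have b : Basis (Fin 2) ℂ (S x) := by
    have : FiniteDimensional ℂ (S x) := .of_finrank_pos (by rw [P.finrank_fiber]; omega)
    exact finBasisOfFinrankEq ℂ (S x) (P.finrank_fiber x)
  -- Indexing by smooth fields rather than by vectors avoids any appeal to tensoriality of the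
  -- curvature. The area identities come from the auxiliary curvature on the pairs `(φ, γ(Z)φ)` and
  -- `(γ(Z)φ, γ(Z')φ)`.
  have := hγ.eq_cross_of_areaForm hf b hx hσ
    (ι := {Z : ∀ x : M, TangentSpace 𝓘(ℝ, E) x // SmoothField Z})
    (ev := fun Z => Z.1 x) (r := fun Z => curvature cov X Y Z.1 x)
    (fun v => by
      obtain ⟨Z, hZ, h⟩ := exists_smoothField_apply_eq x v
      exact ⟨⟨Z, hZ⟩, h⟩)
    u (Ω x (X x) (Y x))
    (fun Z => by
      have h := hΩ X Y hX hY φ _ hφ (P.smoothSpinor_γ Z.2 hφ) x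
      rw [hR, hRZ Z.1 Z.2] at h
      exact areaForm_of_detWedge b h)
    (fun Z Z' => by
      have h := hΩ X Y hX hY _ _ (P.smoothSpinor_γ Z.2 hφ) (P.smoothSpinor_γ Z'.2 hφ) x
      rw [hRZ Z.1 Z.2, hRZ Z'.1 Z'.2] at h
      exact areaForm_of_detWedge b h) ⟨Z, hZ⟩
  rw [this]
  congr 2
  rw [hu]
  module

/-- If the spinor `φ` of direction `σ` satisfies `∇_X φ = (ε / 2) γ(A X) φ` with `ε = ± 1`, and
the ambient Gauss and Codazzi terms combine to the auxiliary curvature in the direction `σ`,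
then the Gauss and Codazzi equations are equivalent. -/
theorem gaussEquation_iff_codazziEquation [T2Space M] [PreconnectedSpace M]
    (hE : finrank ℝ E = 3) (hcov : IsLeviCivita cov)
    {C : AlmostContact (E := E) M} (ho : C.IsOriented o)
    {Ω : ∀ x : M, TangentSpace 𝓘(ℝ, E) x →L[ℝ] TangentSpace 𝓘(ℝ, E) x →L[ℝ] ℝ}
    (hΩ : P.IsAuxiliaryCurvature Ω) {c₁ c₂ : ℝ}
    {A : ∀ x : M, TangentSpace 𝓘(ℝ, E) x →L[ℝ] TangentSpace 𝓘(ℝ, E) x} (hA : SmoothEndo A)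
    {V : ∀ x : M, TangentSpace 𝓘(ℝ, E) x} {h : M → ℝ}
    {φ : ∀ x : M, S x} (hφ : SmoothSpinor E F φ) (hφ0 : ∀ x, φ x ≠ 0) {ε : ℝ} (hε : ε ^ 2 = 1)
    (hκ : ∀ x v, P.conn φ x v = (ε / 2) • P.γ x (A x v) (φ x))
    {σ : ∀ x : M, TangentSpace 𝓘(ℝ, E) x}
    (hσ : ∀ x, P.γ x (σ x) (φ x) = -(Complex.I • φ x))
    (hc : ∀ (x : M) (e : OrthonormalBasis (Fin 3) ℝ (TangentSpace 𝓘(ℝ, E) x)), C.IsAdapted e →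
      ∀ X Y, gaussVector (C.χ x : TangentSpace 𝓘(ℝ, E) x →ₗ[ℝ] TangentSpace 𝓘(ℝ, E) x) (C.ξ x)
          c₁ c₂ (h x) (V x) X Y
        + ε • codazziVector (C.χ x : TangentSpace 𝓘(ℝ, E) x →ₗ[ℝ] TangentSpace 𝓘(ℝ, E) x)
          (C.ξ x) c₁ c₂ (h x) (V x) X Y =
        -(twoForm e (Ω x (e 0) (e 1)) (Ω x (e 0) (e 2)) (Ω x (e 1) (e 2)) X Y) • σ x) :
    GaussEquation cov C c₁ c₂ A V h ↔ CodazziEquation cov C c₁ c₂ A V h := by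
  have hε0 : ε ≠ 0 := by rintro rfl; norm_num at hε
  have hfr := C.exists_isAdapted hE
  rw [gaussEquation_iff hfr, codazziEquation_iff hfr]
  -- Antisymmetry of `Ω` is inherited from that of the curvature: the other terms of the axial
  -- vector are antisymmetric in `X`, `Y`, and `σ ≠ 0`.
  have halt : ∀ x u v, Ω x u v = -Ω x v u := by
    intro x u v
    obtain ⟨e, he⟩ := hfr x
    have hf := he.isRotationFrame
    obtain ⟨X, hX, rfl⟩ := exists_smoothField_apply_eq x u
    obtain ⟨Y, hY, rfl⟩ := exists_smoothField_apply_eq x v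
    have hz : (Ω x (X x) (Y x) + Ω x (Y x) (X x)) • σ x = 0 := by
      apply hf.eq_zero_of_cross
      intro w
      obtain ⟨Z, hZ, rfl⟩ := exists_smoothField_apply_eq x w
      have h1 := P.curvature_eq_cross hcov ho hΩ hA hφ hε hκ (hφ0 x) (hσ x) he hX hY hZ
      have h2 := P.curvature_eq_cross hcov ho hΩ hA hφ hε hκ (hφ0 x) (hσ x) he hY hX hZ
      have h3 := add_eq_zero_iff_eq_neg.2 (curvature_swap cov X Y Z x)
      rw [h1, h2, ← cross_add_left, dNabla_swap, hf.cross_swap (A x (X x))] at h3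
      rw [← h3]
      congr 1
      module
    have hσ0 : σ x ≠ 0 := by
      intro h0
      have := hσ x
      rw [h0, map_zero] at this
      simp [hφ0 x] at this
    exact eq_neg_of_add_eq_zero_left ((smul_eq_zero.1 hz).resolve_right hσ0)
  -- The defect of the Gauss equation is `ε` times the cross product with the defect of the Codazzi
  -- equation.
  have key : ∀ X Y Z : ∀ x : M, TangentSpace 𝓘(ℝ, E) x,
      SmoothField X → SmoothField Y → SmoothField Z → ∀ x : M,
      curvature cov X Y Z x =
        -cross (C.χ x : TangentSpace 𝓘(ℝ, E) x →ₗ[ℝ] TangentSpace 𝓘(ℝ, E) x) (C.ξ x)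
          (gaussVector (C.χ x : TangentSpace 𝓘(ℝ, E) x →ₗ[ℝ] TangentSpace 𝓘(ℝ, E) x) (C.ξ x)
            c₁ c₂ (h x) (V x) (X x) (Y x)
          + cross (C.χ x : TangentSpace 𝓘(ℝ, E) x →ₗ[ℝ] TangentSpace 𝓘(ℝ, E) x) (C.ξ x)
            (A x (X x)) (A x (Y x))) (Z x)
        + ε • cross (C.χ x : TangentSpace 𝓘(ℝ, E) x →ₗ[ℝ] TangentSpace 𝓘(ℝ, E) x) (C.ξ x)
          (dNabla cov A X Y x
            - codazziVector (C.χ x : TangentSpace 𝓘(ℝ, E) x →ₗ[ℝ] TangentSpace 𝓘(ℝ, E) x)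
              (C.ξ x) c₁ c₂ (h x) (V x) (X x) (Y x)) (Z x) := by
    intro X Y Z hX hY hZ x
    obtain ⟨e, he⟩ := hfr x
    have hΩe : Ω x (X x) (Y x) =
        twoForm e (Ω x (e 0) (e 1)) (Ω x (e 0) (e 2)) (Ω x (e 1) (e 2)) (X x) (Y x) :=
      eq_twoForm_of_alternating e (LinearMap.mk₂ ℝ (fun u v => Ω x u v)
        (by simp) (by simp) (by simp) (by simp)) (halt x) (X x) (Y x)
    rw [P.curvature_eq_cross hcov ho hΩ hA hφ hε hκ (hφ0 x) (hσ x) he hX hY hZ, hΩe,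
      ← neg_eq_iff_eq_neg.2 ((hc x e he (X x) (Y x)).trans (neg_smul _ _)), ← neg_one_smul ℝ
      (cross _ _ _ (Z x)), ← cross_smul_left, ← cross_smul_left, ← cross_add_left]
    congr 1
    module
  constructor
  · intro H X Y hX hY x
    obtain ⟨e, he⟩ := hfr x
    refine sub_eq_zero.1 (he.isRotationFrame.eq_zero_of_cross fun v => ?_)
    obtain ⟨Z, hZ, rfl⟩ := exists_smoothField_apply_eq x v
    have h1 := key X Y Z hX hY hZ x
    rw [H X Y Z hX hY hZ x, left_eq_add, smul_eq_zero] at h1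
    exact h1.resolve_left hε0
  · intro H X Y Z hX hY hZ x
    rw [key X Y Z hX hY hZ x, H X Y hX hY x, sub_self]
    simp [cross]

end SpincStructure

end Main

end

/-! ### The two cases of the theorem -/

theorem mainTheorem6
    {E : Type*} [NormedAddCommGroup E] [NormedSpace ℝ E] [FiniteDimensional ℝ E]
    (hE : finrank ℝ E = 3)
    {M : Type*} [TopologicalSpace M] [T2Space M] [SecondCountableTopology M] [ConnectedSpace M]
    [ChartedSpace E M] [IsManifold 𝓘(ℝ, E) ∞ M]
    [RiemannianBundle (fun x : M => TangentSpace 𝓘(ℝ, E) x)]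
    [IsContMDiffRiemannianBundle 𝓘(ℝ, E) ∞ E (fun x : M => TangentSpace 𝓘(ℝ, E) x)]
    (cov : CovariantDerivative 𝓘(ℝ, E) E (TangentSpace 𝓘(ℝ, E) : M → Type _))
    (hcov : IsLeviCivita cov)
    (C : AlmostContact (E := E) M)
    (o : ∀ x : M, Orientation ℝ (TangentSpace 𝓘(ℝ, E) x) (Fin 3)) (ho : C.IsOriented o)
    {F : Type*} [NormedAddCommGroup F] [NormedSpace ℂ F] [FiniteDimensional ℂ F]
    {S : M → Type*} [TopologicalSpace (TotalSpace F S)]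
    [∀ x, NormedAddCommGroup (S x)] [∀ x, InnerProductSpace ℂ (S x)]
    [FiberBundle F S] [VectorBundle ℂ F S] [VectorBundle ℝ F S]
    [ContMDiffVectorBundle ∞ F S 𝓘(ℝ, E)]
    [IsContMDiffRiemannianBundle 𝓘(ℝ, E) ∞ F S]
    (P : SpincStructure cov o (F := F) S)
    (Ω : ∀ x : M, TangentSpace 𝓘(ℝ, E) x →L[ℝ] TangentSpace 𝓘(ℝ, E) x →L[ℝ] ℝ)
    (hΩ : P.IsAuxiliaryCurvature Ω)
    (c₁ c₂ : ℝ)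
    (A : ∀ x : M, TangentSpace 𝓘(ℝ, E) x →L[ℝ] TangentSpace 𝓘(ℝ, E) x) (hA : SmoothEndo A)
    (hAsymm : ∀ x (v w : TangentSpace 𝓘(ℝ, E) x), inner ℝ (A x v) w = inner ℝ v (A x w))
    (V : ∀ x : M, TangentSpace 𝓘(ℝ, E) x) (hV : SmoothField V)
    (h : M → ℝ) (hh : ContMDiff 𝓘(ℝ, E) 𝓘(ℝ, ℝ) ∞ h)
    (φ : ∀ x : M, S x) (hφ : SmoothSpinor E F φ) (hφ0 : φ ≠ 0) :
    ((∀ x, inner ℝ (V x) (C.ξ x) = (0 : ℝ)) →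
      (∀ x, h x ^ 2 + ‖V x‖ ^ 2 = 1) →
      (∀ x (v : TangentSpace 𝓘(ℝ, E) x), P.conn φ x v = -((1 / 2 : ℝ) • P.γ x (A x v) (φ x))) →
      (∀ x, P.γ x (C.ξ x) (φ x) = -(Complex.I • φ x)) →
      (∀ (x : M) (e : OrthonormalBasis (Fin 3) ℝ (TangentSpace 𝓘(ℝ, E) x)), C.IsAdapted e →
        Ω x (e 0) (e 1) = c₁ / 2 * (h x - 1) - c₂ / 2 * (h x + 1) ∧
        Ω x (e 0) (e 2) = (c₁ - c₂) / 2 * inner ℝ (V x) (e 0) ∧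
        Ω x (e 1) (e 2) = (c₁ - c₂) / 2 * inner ℝ (V x) (e 1)) →
      (GaussEquation cov C c₁ c₂ A V h ↔ CodazziEquation cov C c₁ c₂ A V h))
    ∧
    ((∀ x (v : TangentSpace 𝓘(ℝ, E) x), P.conn φ x v = (1 / 2 : ℝ) • P.γ x (A x v) (φ x)) →
      (∀ x, P.γ x (V x) (φ x) = -(Complex.I • P.γ x (C.ξ x) (φ x)) + h x • φ x) →
      (∀ (x : M) (e : OrthonormalBasis (Fin 3) ℝ (TangentSpace 𝓘(ℝ, E) x)), C.IsAdapted e →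
        Ω x (e 0) (e 1) = -(c₁ / 2) * (h x - 1) - c₂ / 2 * (h x + 1) ∧
        Ω x (e 0) (e 2) = -((c₁ + c₂) / 2) * inner ℝ (e 0) (V x) ∧
        Ω x (e 1) (e 2) = -((c₁ + c₂) / 2) * inner ℝ (e 1) (V x)) →
      (GaussEquation cov C c₁ c₂ A V h ↔ CodazziEquation cov C c₁ c₂ A V h)) := by
  constructor
  · intro hVξ hn hκ hσ hΩe
    have hκ' : ∀ x v, P.conn φ x v = ((-1 : ℝ) / 2) • P.γ x (A x v) (φ x) := fun x v => by
      rw [hκ, neg_div, neg_smul]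
    -- Case (1): `ε = -1` and `σ = ξ`.
    refine P.gaussEquation_iff_codazziEquation hE hcov ho hΩ hA hφ
      (P.ne_zero_of_killing hφ hκ' hφ0) (by norm_num) hκ' hσ fun x e he X Y => ?_
    obtain ⟨h01, h02, h12⟩ := hΩe x e he
    rw [h01, h02, h12, neg_one_smul, ← sub_eq_add_neg]
    refine he.isRotationFrame.gaussVector_sub_codazziVector ?_ ?_ X Y
    · rw [he.2, real_inner_comm, hVξ]
    · rw [real_inner_self_eq_norm_sq, hn]
  · intro hκ hV hΩe
    have hdir : ∀ (x : M) (e : OrthonormalBasis (Fin 3) ℝ (TangentSpace 𝓘(ℝ, E) x)),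
        C.IsAdapted e → inner ℝ (e 2) (V x) = (0 : ℝ) ∧ h x ^ 2 + inner ℝ (V x) (V x) = 1 ∧
          P.γ x (h x • C.ξ x - C.χ x (V x)) (φ x) = -(Complex.I • φ x) := fun x e he =>
      (P.isCliffordAction ho he).direction_of_apply_eq he.isRotationFrame
        (P.ne_zero_of_killing hφ hκ hφ0 x) (hV x)
    -- Case (2): `hdir` supplies the direction `hξ - χV` and the two constraints on `V` and `h`.
    refine P.gaussEquation_iff_codazziEquation (ε := 1)
      (σ := fun x => h x • C.ξ x - C.χ x (V x)) hE hcov ho hΩ hA hφ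
      (P.ne_zero_of_killing hφ hκ hφ0) (by norm_num) hκ (fun x => ?_) fun x e he X Y => ?_
    · obtain ⟨e, he⟩ := C.exists_isAdapted hE x
      exact (hdir x e he).2.2
    · obtain ⟨h01, h02, h12⟩ := hΩe x e he
      obtain ⟨hperp, hn, -⟩ := hdir x e he
      rw [h01, h02, h12, one_smul]
      exact he.isRotationFrame.gaussVector_add_codazziVector hperp hn X Y
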